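/- **Theorem ((Exact) DDP for generalized scoring rules).** Fix $m\ge 2$, let $\mathcal C$ be a set of $m$ alternatives and $\mathcal L(\mathcal C)$ the set of its $m!$ linear orders (rankings). A profile is a histogram $P\in\mathbb N^{\mathcal L(\mathcal C)}$ of votes. A *generalized scoring rule* (GSR) is given by finitely many hyperplanes through the origin with nonzero normal vectors $H=\{\vec h_1,\dots,\vec h_R\}\subset\mathbb R^{m!}$ and a map $g_H:\{+,0,-\}^R\to\mathcal C$; its winner at $\vec p\in\mathbb R^{m!}$ (in particular at a profile) is $r(\vec p)=g_H(\mathrm{Sign}(\vec h_1\cdot\vec p),\dots,\mathrm{Sign}(\vec h_R\cdot\vec p))$. Suppose that $r$ satisfies - *canceling-out*: $r(P)=r(P+\vec 1)$ for every profile $P$; - *monotonicity*: if $r(P)=a$ and one vote $W$ of $P$ is replaced by a vote $V$ obtained from $W$ by raising $a$ while keeping the order of the other alternatives, then the winner is still $a$; - *local stability*: there are a profile $P^*$, a number $\gamma>0$, an alternative $a$, and rankings $W,V$ with $V$ obtained from $W$ by raising $a$ while keeping the order of the other alternatives, such that for every $\vec p\in\mathbb R^{m!}$ with $\|\vec p-P^*\|_\infty\le\gamma$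 one has $r(\vec p)\ne a$, and the winner is $a$ once all $W$ votes of $\vec p$ are turned into $V$ votes. Let $\mathbf M$ be the mechanism that maps a database (a finite list) of votes to the winner of its histogram. For a probability vector $\vec\pi$ on $\mathcal L(\mathcal C)$ let $X\sim D^n_{\vec\pi}$ be the database of $n$ i.i.d. votes of law $\vec\pi$. For real $\epsilon,\delta\ge 0$, $\mathbf M$ is $(\epsilon,\delta)$-DDP for $D^n_{\vec\pi}$ (without auxiliary information) if there is a randomized simulator $\mathbf{Sim}$ such that for every row $i$, every $x$ in the support of $X_i$ and every set $\mathcal S$ of outputs, $$\Pr(\mathbf M(X)\in\mathcal S\mid X_i=x)\le e^{\epsilon}\Pr(\mathbf{Sim}(X_{-i})\in\mathcal S\mid X_i=x)+\delta,$$ $$\Pr(\mathbf{Sim}(X_{-i})\in\mathcal S\mid X_i=x)\le e^{\epsilon}\Pr(\mathbf M(X)\in\mathcal S\mid X_i=x)+\delta;$$ it is $(\epsilon,\delta)$-DDP in the simulator-free sense if $\Pr(\mathbf M(X)\in\mathcal S\mid X_i=x)\le e^{\epsilon}\Pr(\mathbf M(X)\in\mathcal S\mid X_i=x')+\delta$ for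 all $i$, all $x,x'$ in the support of $X_i$ and all $\mathcal S$. It is *exactly* $(\epsilon,\delta)$-DDP if it is $(\epsilon,\delta)$-DDP and is not $(\epsilon',\delta')$-DDP for any $\epsilon',\delta'\ge 0$ with ($\epsilon'\le\epsilon$ and $\delta'<\delta$) or ($\epsilon'<\epsilon$ and $\delta'\le\delta$). Then, for each of the two senses of DDP: 1. If $\vec\pi$ is uniform, there is $\delta(n)=\Theta(1/\sqrt n)$ as $n\to\infty$ such that $\mathbf M$ is exactly $(0,\delta(n))$-DDP for $D^n_{\vec\pi}$, for every $n\ge 1$. 2. For every fixed $\vec\pi$ with $\vec\pi[V]>0$ for all $V$, $\mathbf M$ is $(0,\delta(n))$-DDP for $D^n_{\vec\pi}$ for every $n\ge 1$, with $$\delta(n)=O\left(\min\left\{\exp\left(-\frac{\left[\min_{\vec h\in H}\mathrm{Dist}(\vec\pi,\vec h)\right]^2}{3\,(m!)\,\max_{V}\vec\pi[V]}\cdot n\right),\ \sqrt{\frac1n}\right\}\right),\qquad \mathrm{Dist}(\vec\pi,\vec h)=\frac{|\vec\pi\cdot\vec h|}{\|\vec h\|_2}.$$ -/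

import Mathlib

open scoped NNReal ENNReal

namespace VotingDDP

noncomputable section

/-! ### Rankings, profiles, generalized scoring rules -/

/-- A linear order (ranking, vote) on the `m` alternatives `Fin m`, encoded by its rank function:
`V c` is the position of `c`, position `0` being the top. -/
abbrev Ranking (m : ℕ) : Type := Equiv.Perm (Fin m)

/-- `V` is obtained from `W` by raising the position of `a`, without changing the order of the
other alternatives. -/
def Raises {m : ℕ} (a : Fin m) (W V : Ranking m) : Prop :=
  V a < W a ∧ ∀ b c : Fin m, b ≠ a → c ≠ a → (V b < V c ↔ W b < W c)

/-- The histogram (anonymous profile) of a database of votes. -/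
def hist {m : ℕ} (d : List (Ranking m)) : Ranking m → ℕ := fun V => d.count V

/-- The profile `P` with one `W` vote replaced by a `V` vote (used when `W` occurs in `P`). -/
def replaceOne {m : ℕ} (P : Ranking m → ℕ) (W V : Ranking m) : Ranking m → ℕ :=
  P - Pi.single W 1 + Pi.single V 1

/-- The real profile `p` with all `W` votes turned into `V` votes (used for `V ≠ W`). -/
def replaceAll {m : ℕ} (p : Ranking m → ℝ) (W V : Ranking m) : Ranking m → ℝ :=
  p - Pi.single W (p W) + Pi.single V (p W)

/-- A generalized scoring rule over `m` alternatives: finitely many hyperplanes through the origin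
of `ℝ^{m!}`, given by nonzero normal vectors `h j`, and a map `g` from sign vectors to
alternatives. -/
structure GSR (m : ℕ) where
  /-- the number of hyperplanes -/
  R : ℕ
  /-- the normal vectors -/
  h : Fin R → Ranking m → ℝ
  h_ne_zero : ∀ j, h j ≠ 0
  /-- the alternative selected for each vector of signs -/
  g : (Fin R → SignType) → Fin m

/-- The winner at a point of `ℝ^{m!}`. -/
def GSR.winner {m : ℕ} (r : GSR m) (p : Ranking m → ℝ) : Fin m :=
  r.g fun j => SignType.sign (∑ V, r.h j V * p V)

/-- The voting rule on profiles (histograms of votes). -/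
def GSR.rule {m : ℕ} (r : GSR m) (P : Ranking m → ℕ) : Fin m :=
  r.winner fun V => (P V : ℝ)

/-- Adding a copy of every ranking does not change the winner. -/
def CancelingOut {m : ℕ} (r : (Ranking m → ℕ) → Fin m) : Prop :=
  ∀ P : Ranking m → ℕ, r P = r fun V => P V + 1

/-- Raising the winner in a vote, keeping the order of the other alternatives, does not prevent it
from winning. -/
def MonotoneRule {m : ℕ} (r : (Ranking m → ℕ) → Fin m) : Prop :=
  ∀ (P : Ranking m → ℕ) (W V : Ranking m),
    0 < P W → Raises (r P) W V → r (replaceOne P W V) = r P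

/-- The profile `P` is locally stable: for some `γ > 0` the condition holds on the closed
`L_∞`-ball of radius `γ` around `P` in `ℝ^{m!}`. -/
def LocallyStable {m : ℕ} (r : GSR m) (P : Ranking m → ℕ) : Prop :=
  ∃ (γ : ℝ) (a : Fin m) (W V : Ranking m), 0 < γ ∧ Raises a W V ∧
    ∀ p : Ranking m → ℝ, (∀ U, |p U - (P U : ℝ)| ≤ γ) →
      r.winner p ≠ a ∧ r.winner (replaceAll p W V) = a

/-- Euclidean distance from the point `x` to the hyperplane with normal vector `h` through `0`. -/
def hyperplaneDist {ι : Type*} [Fintype ι] (x h : ι → ℝ) : ℝ :=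
  |∑ i, x i * h i| / √(∑ i, h i ^ 2)

/-- The mechanism that announces the winner of the rule (it uses no randomness). -/
def GSR.mechanism {m : ℕ} (r : GSR m) (d : List (Ranking m)) : PMF (Fin m) :=
  PMF.pure (r.rule (hist d))

/-! ### Distributional differential privacy -/

section Privacy

variable {U R Z : Type*}

/-- The distribution of an `n`-row database with i.i.d. rows of law `π`. -/
def iidDatabase [Fintype U] (π : PMF U) (n : ℕ) : PMF (List U) :=
  (PMF.ofFintype (fun d : Fin n → U => ∏ i, π (d i)) (by
    classical
    have h1 : ∑ x, π x = 1 := by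
      rw [← π.tsum_coe, tsum_fintype]
    rw [← Fintype.piFinset_univ, ← Finset.prod_univ_sum, h1, Finset.prod_const_one])).map List.ofFn

/-- A database distribution without auxiliary information. -/
def noAux (X : PMF (List U)) : PMF (List U × Unit) := X.map fun d => (d, ())

/-- The event that row `i` of the database equals `x` and the auxiliary information is `z`. -/
def rowEvent (i : ℕ) (x : U) (z : Z) : Set (List U × Z) :=
  {d | d.1[i]? = some x ∧ d.2 = z}

/-- The event that row `i` of the database equals `x`. -/
def rowIs (i : ℕ) (x : U) : Set (List U) := {d | d[i]? = some x}

/-- `(ε, δ, Δ)`-distributional differential privacy (simulation-based) of the randomized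
mechanism `M` on databases of any size; `Δ` is a set of joint laws of a database and auxiliary
information. The simulator sees the database without row `i`, and `D.filter _ h` is `D` conditioned
on the event that `X_i = x, Z = z`, which has positive probability by `h`. -/
def IsDDP (M : List U → PMF R) (Δ : Set (PMF (List U × Z))) (ε δ : ℝ≥0) : Prop :=
  ∃ Sim : List U → PMF R, ∀ D ∈ Δ, ∀ (i : ℕ) (x : U) (z : Z)
    (h : ∃ d ∈ rowEvent i x z, d ∈ D.support) (S : Set R),
    ((D.filter _ h).bind fun d => M d.1).toOuterMeasure S ≤
        ENNReal.ofReal (Real.exp ε) *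
          ((D.filter _ h).bind fun d => Sim (d.1.eraseIdx i)).toOuterMeasure S + δ ∧
      ((D.filter _ h).bind fun d => Sim (d.1.eraseIdx i)).toOuterMeasure S ≤
        ENNReal.ofReal (Real.exp ε) *
          ((D.filter _ h).bind fun d => M d.1).toOuterMeasure S + δ

/-- The simulator-free form of `(ε, δ, Δ)`-distributional differential privacy, for database laws
without auxiliary information: changing the value on which row `i` is conditioned changes the
output law by at most `(ε, δ)`. -/
def IsPairwiseDDP (M : List U → PMF R) (Δ : Set (PMF (List U))) (ε δ : ℝ≥0) : Prop :=
  ∀ X ∈ Δ, ∀ (i : ℕ) (x x' : U)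
    (h : ∃ d ∈ rowIs i x, d ∈ X.support) (h' : ∃ d ∈ rowIs i x', d ∈ X.support) (S : Set R),
    ((X.filter _ h).bind M).toOuterMeasure S ≤
      ENNReal.ofReal (Real.exp ε) * ((X.filter _ h').bind M).toOuterMeasure S + δ

/-- `(ε, δ)` are exact parameters for a two-parameter privacy notion `Q`: they are achieved, and no
strictly better parameters are. -/
def IsExact (Q : ℝ≥0 → ℝ≥0 → Prop) (ε δ : ℝ≥0) : Prop :=
  Q ε δ ∧ ¬ ∃ ε' δ' : ℝ≥0, ((ε' ≤ ε ∧ δ' < δ) ∨ (ε' < ε ∧ δ' ≤ δ)) ∧ Q ε' δ'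

end Privacy

end

end VotingDDP

open scoped Asymptotics
open VotingDDP

namespace VotingDDP

noncomputable section

/-! ### Conditioning an i.i.d. database on one row -/

section Conditioning

variable {U R Z : Type*}

/-! The votes are independent and the winner ignores their order. Conditioning on one row being `x`
therefore leaves the output law `rowOutput` of `x` followed by i.i.d. votes, while any simulator
produces a law that does not depend on `x`. At `ε = 0` both senses of privacy measure how far apart
the finitely many laws `rowOutput M π n x` are: the pairwise sense by their diameter in total
variation, the simulation sense by the radius of the smallest ball containing them. Compactness of
the simplex makes the radius attained, hence exact, and it lies between half the diameter and the
diameter. All estimates can thus be made on `pairwiseOptimum`.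

Upper bound of order `1 / √n` (`exists_prob_rowOutput_sub_le_div_sqrt`): by exchangeability a
conditional probability is the expectation of the winner's indicator weighted by the frequency of
`x`. A difference of two of them is an expectation against a centred i.i.d. sum divided by the
number of rows, and the variance of that sum controls it.

Exponential bound (`pairwiseOptimum_le_exp`): a Chernoff estimate shows that the profile lies on the
same side of every hyperplane as `π`, outside an exponentially small event. The winner is then the
winner at `π`, whatever the fixed vote is.

Lower bound for the uniform law (`exists_div_sqrt_le_pairwiseOptimum`): let `N = m!`. Near the ray
of a locally stable profile, turning `W` votes into `V` votes one at a time must at some moment make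
`a` win, which gives a profile where a single vote is decisive. Canceling-out moves these profiles
along the diagonal, to within `O(√n)` of the uniform profile of size `n`. Varying the other `N - 2`
coordinates yields of order `n ^ ((N - 2) / 2)` distinct ones, and Stirling gives each a probability
at least of order `n ^ (-(N - 1) / 2)`. The product is `1 / √n`. Monotonicity rules out cancellation
by the remaining profiles. -/

theorem iidDatabase_apply [Fintype U] (π : PMF U) (n : ℕ) (l : List U) :
    iidDatabase π n l = if l.length = n then (l.map π).prod else 0 := by
  classical
  rw [iidDatabase, PMF.map_apply]
  split_ifs with hl
  · subst hl
    rw [tsum_eq_single l.get]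
    · simp only [List.ofFn_get, if_true, PMF.ofFintype_apply]
      conv_rhs => rw [← List.ofFn_get l, List.map_ofFn, List.prod_ofFn]
      rfl
    · intro d hd
      rw [if_neg]
      intro h
      apply hd
      apply List.ofFn_injective
      rw [← h, List.ofFn_get]
  · rw [ENNReal.tsum_eq_zero]
    intro d
    rw [if_neg]
    rintro rfl
    simp at hl

theorem map_insertIdx_iidDatabase_apply [Fintype U] (π : PMF U) {n i : ℕ} (hi : i ≤ n) (x : U)
    (l : List U) :
    (iidDatabase π n).map (fun d => d.insertIdx i x) l =
      (rowIs i x).indicator (fun l => iidDatabase π n (l.eraseIdx i)) l := by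
  classical
  rw [PMF.map_apply]
  by_cases hl : l ∈ rowIs i x
  · have hl' : l[i]? = some x := hl
    obtain ⟨hlt, hx⟩ := List.getElem?_eq_some_iff.1 hl'
    rw [Set.indicator_of_mem hl, tsum_eq_single (l.eraseIdx i)]
    · rw [if_pos]
      rw [← hx, List.insertIdx_eraseIdx_getElem hlt]
    · intro d hd
      rw [if_neg]
      rintro rfl
      exact hd (List.eraseIdx_insertIdx_self ..).symm
  · rw [Set.indicator_of_notMem hl, ENNReal.tsum_eq_zero]
    intro d
    -- Insertion beyond the end of a list would leave it unchanged. Only lists of length `n ≥ i`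
    -- carry mass, and there the insertion does put `x` in row `i`.
    by_cases hd : d.length = n
    · rw [if_neg]
      rintro rfl
      apply hl
      change (d.insertIdx i x)[i]? = some x
      rw [List.getElem?_insertIdx_self, if_pos (by omega)]
    · rw [iidDatabase_apply, if_neg hd, ite_self]

theorem iidDatabase_succ_indicator_rowIs [Fintype U] (π : PMF U) {n i : ℕ} (hi : i ≤ n) (x : U)
    (l : List U) :
    (rowIs i x).indicator (iidDatabase π (n + 1)) l =
      π x * (iidDatabase π n).map (fun d => d.insertIdx i x) l := by
  rw [map_insertIdx_iidDatabase_apply π hi]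
  by_cases hl : l ∈ rowIs i x
  · have hl' : l[i]? = some x := hl
    obtain ⟨hlt, hx⟩ := List.getElem?_eq_some_iff.1 hl'
    rw [Set.indicator_of_mem hl, Set.indicator_of_mem hl, iidDatabase_apply, iidDatabase_apply,
      List.length_eraseIdx_of_lt hlt]
    have hperm : (l.map π).prod = π x * ((l.eraseIdx i).map π).prod := by
      rw [← List.prod_cons, ← List.map_cons, ← hx]
      exact ((List.getElem_cons_eraseIdx_perm hlt).map π).prod_eq.symm
    by_cases hn : l.length = n + 1
    · rw [if_pos hn, if_pos (by omega), hperm]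
    · rw [if_neg hn, if_neg (by omega), mul_zero]
  · rw [Set.indicator_of_notMem hl, Set.indicator_of_notMem hl, mul_zero]

/-- Independence of the rows: the event has probability `π x`, which cancels the factor that row `i`
contributes to each database. -/
theorem iidDatabase_filter_rowIs [Fintype U] (π : PMF U) {n i : ℕ} (hi : i ≤ n) (x : U)
    (h : ∃ d ∈ rowIs i x, d ∈ (iidDatabase π (n + 1)).support) :
    (iidDatabase π (n + 1)).filter (rowIs i x) h =
      (iidDatabase π n).map fun d => d.insertIdx i x := by
  have htot : ∑' l, (rowIs i x).indicator (iidDatabase π (n + 1)) l = π x := by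
    simp_rw [iidDatabase_succ_indicator_rowIs π hi, ENNReal.tsum_mul_left, PMF.tsum_coe, mul_one]
  have hpos : π x ≠ 0 := by
    obtain ⟨d, hd, hd'⟩ := h
    intro h0
    have := iidDatabase_succ_indicator_rowIs π hi x d
    rw [Set.indicator_of_mem hd, h0, zero_mul] at this
    exact hd' this
  refine PMF.ext fun l => ?_
  rw [PMF.filter_apply, htot, iidDatabase_succ_indicator_rowIs π hi, mul_right_comm,
    ENNReal.mul_inv_cancel hpos (π.apply_ne_top x), one_mul]

theorem exists_mem_rowIs_support_iff [Fintype U] (π : PMF U) (n i : ℕ) (x : U) :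
    (∃ d ∈ rowIs i x, d ∈ (iidDatabase π (n + 1)).support) ↔ i ≤ n ∧ π x ≠ 0 := by
  constructor
  · rintro ⟨d, hd, hd'⟩
    have hd1 : d[i]? = some x := hd
    have hd2 : iidDatabase π (n + 1) d ≠ 0 := hd'
    obtain ⟨hlt, -⟩ := List.getElem?_eq_some_iff.1 hd1
    have hlen : d.length = n + 1 := by
      by_contra hne
      exact hd2 (by rw [iidDatabase_apply, if_neg hne])
    have hi : i ≤ n := by omega
    refine ⟨hi, fun h0 => hd2 ?_⟩
    have := iidDatabase_succ_indicator_rowIs π hi x d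
    rwa [Set.indicator_of_mem hd, h0, zero_mul] at this
  · rintro ⟨hi, hx⟩
    obtain ⟨l, hl⟩ := ((iidDatabase π n).map fun d => d.insertIdx i x).support_nonempty
    have hne : (rowIs i x).indicator (iidDatabase π (n + 1)) l ≠ 0 := by
      rw [iidDatabase_succ_indicator_rowIs π hi]
      exact mul_ne_zero hx hl
    exact ⟨l, Set.mem_of_indicator_ne_zero hne, by
      rwa [Set.indicator_of_mem (Set.mem_of_indicator_ne_zero hne)] at hne⟩

theorem noAux_apply (X : PMF (List U)) (l : List U) (z : Unit) : noAux X (l, z) = X l := by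
  classical
  rw [noAux, PMF.map_apply, tsum_eq_single l]
  · simp
  · intro d hd
    rw [if_neg]
    intro h
    exact hd (congrArg Prod.fst h).symm

theorem exists_mem_rowEvent_support_noAux_iff (X : PMF (List U)) (i : ℕ) (x : U) (z : Unit) :
    (∃ d ∈ rowEvent i x z, d ∈ (noAux X).support) ↔ ∃ d ∈ rowIs i x, d ∈ X.support := by
  constructor
  · rintro ⟨⟨d, u⟩, hd, hd'⟩
    refine ⟨d, hd.1, ?_⟩
    rw [PMF.mem_support_iff, noAux_apply] at hd'
    exact hd'
  · rintro ⟨d, hd, hd'⟩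
    refine ⟨(d, z), ⟨hd, rfl⟩, ?_⟩
    rw [PMF.mem_support_iff, noAux_apply]
    exact hd'

theorem noAux_filter_rowEvent (X : PMF (List U)) (i : ℕ) (x : U) (z : Unit)
    (h : ∃ d ∈ rowEvent i x z, d ∈ (noAux X).support) (h' : ∃ d ∈ rowIs i x, d ∈ X.support) :
    (noAux X).filter _ h = noAux (X.filter _ h') := by
  have hind : ∀ l u, (rowEvent i x z).indicator (noAux X) (l, u) = (rowIs i x).indicator X l := by
    intro l u
    by_cases hl : l ∈ rowIs i x
    · rw [Set.indicator_of_mem hl,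
        Set.indicator_of_mem (show (l, u) ∈ rowEvent i x z from ⟨hl, rfl⟩), noAux_apply]
    · rw [Set.indicator_of_notMem hl, Set.indicator_of_notMem]
      exact fun hmem => hl hmem.1
  refine PMF.ext fun ⟨l, u⟩ => ?_
  rw [noAux_apply, PMF.filter_apply, PMF.filter_apply, hind]
  congr 2
  rw [ENNReal.tsum_prod']
  simp [hind]

/-- The output law of the mechanism when one of the `n + 1` rows is `x` and the others are
i.i.d. -/
def rowOutput [Fintype U] (M : List U → PMF R) (π : PMF U) (n : ℕ) (x : U) : PMF R :=
  (iidDatabase π n).bind fun d => M (x :: d)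

theorem bind_filter_rowIs [Fintype U] {M : List U → PMF R}
    (hM : ∀ l l' : List U, l.Perm l' → M l = M l') (π : PMF U) {n i : ℕ} {x : U}
    (h : ∃ d ∈ rowIs i x, d ∈ (iidDatabase π (n + 1)).support) :
    ((iidDatabase π (n + 1)).filter _ h).bind M = rowOutput M π n x := by
  have hi := ((exists_mem_rowIs_support_iff π n i x).1 h).1
  rw [iidDatabase_filter_rowIs π hi, PMF.bind_map]
  refine PMF.ext fun b => ?_
  rw [rowOutput, PMF.bind_apply, PMF.bind_apply]
  congr 1
  funext d
  by_cases hd : d.length = n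
  · rw [Function.comp_apply, hM _ _ (List.perm_insertIdx x d (by omega))]
  · rw [iidDatabase_apply, if_neg hd, zero_mul, zero_mul]

theorem isPairwiseDDP_iidDatabase_iff [Fintype U] {M : List U → PMF R}
    (hM : ∀ l l' : List U, l.Perm l' → M l = M l') {π : PMF U} (hπ : ∀ x, 0 < π x) (n : ℕ)
    (δ : ℝ≥0) :
    IsPairwiseDDP M {iidDatabase π (n + 1)} 0 δ ↔ ∀ (x x' : U) (S : Set R),
      (rowOutput M π n x).toOuterMeasure S ≤ (rowOutput M π n x').toOuterMeasure S + δ := by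
  simp only [IsPairwiseDDP, Set.mem_singleton_iff, forall_eq, bind_filter_rowIs hM, NNReal.coe_zero,
    Real.exp_zero, ENNReal.ofReal_one, one_mul, exists_mem_rowIs_support_iff]
  exact ⟨fun H x x' S => H 0 x x' ⟨Nat.zero_le _, (hπ x).ne'⟩ ⟨Nat.zero_le _, (hπ x').ne'⟩ S,
    fun H _ x x' _ _ S => H x x' S⟩

/-- The input of the simulator is independent of the row it does not see, so only its averaged
output law `ν` matters. Conversely, a simulator that ignores its input realizes any `ν`. -/
theorem isDDP_iidDatabase_iff [Fintype U] {M : List U → PMF R}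
    (hM : ∀ l l' : List U, l.Perm l' → M l = M l') {π : PMF U} (hπ : ∀ x, 0 < π x) (n : ℕ)
    (δ : ℝ≥0) :
    IsDDP M {noAux (iidDatabase π (n + 1))} 0 δ ↔ ∃ ν : PMF R, ∀ (x : U) (S : Set R),
      (rowOutput M π n x).toOuterMeasure S ≤ ν.toOuterMeasure S + δ ∧
        ν.toOuterMeasure S ≤ (rowOutput M π n x).toOuterMeasure S + δ := by
  have key : ∀ (i : ℕ) (x : U) (z : Unit)
      (h : ∃ d ∈ rowEvent i x z, d ∈ (noAux (iidDatabase π (n + 1))).support),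
      ((noAux (iidDatabase π (n + 1))).filter _ h).bind (fun d => M d.1) = rowOutput M π n x ∧
      ∀ Sim : List U → PMF R, ((noAux (iidDatabase π (n + 1))).filter _ h).bind
        (fun d => Sim (d.1.eraseIdx i)) = (iidDatabase π n).bind Sim := by
    intro i x z h
    have h' := (exists_mem_rowEvent_support_noAux_iff _ i x z).1 h
    have hi := ((exists_mem_rowIs_support_iff π n i x).1 h').1
    rw [noAux_filter_rowEvent _ _ _ _ h h']
    constructor
    · rw [noAux, PMF.bind_map]
      exact bind_filter_rowIs hM π h'
    · intro Sim
      rw [noAux, PMF.bind_map, iidDatabase_filter_rowIs π hi, PMF.bind_map]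
      congr 1
      funext d
      simp only [Function.comp_apply]
      rw [List.eraseIdx_insertIdx_self]
  simp only [IsDDP, Set.mem_singleton_iff, forall_eq, NNReal.coe_zero, Real.exp_zero,
    ENNReal.ofReal_one, one_mul]
  constructor
  · rintro ⟨Sim, H⟩
    refine ⟨(iidDatabase π n).bind Sim, fun x S => ?_⟩
    have h : ∃ d ∈ rowEvent 0 x (), d ∈ (noAux (iidDatabase π (n + 1))).support := by
      rw [exists_mem_rowEvent_support_noAux_iff, exists_mem_rowIs_support_iff]
      exact ⟨Nat.zero_le _, (hπ x).ne'⟩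
    have := H 0 x () h S
    rwa [(key 0 x () h).1, (key 0 x () h).2] at this
  · rintro ⟨ν, H⟩
    refine ⟨fun _ => ν, fun i x z h S => ?_⟩
    rw [(key i x z h).1, (key i x z h).2 fun _ => ν, PMF.bind_const]
    exact H x S

end Conditioning

/-! ### Optimal parameters of a finite family of output laws -/

section Optimum

variable {ι R : Type*} [Fintype ι] [Fintype R]

/-- No parameter lies below `ε = 0`, so exactness there only asks that `δ` be the least admissible
value. -/
theorem isExact_zero {Q : ℝ≥0 → ℝ≥0 → Prop} {δ : ℝ≥0} (h : ∀ δ', Q 0 δ' ↔ δ ≤ δ') :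
    IsExact Q 0 δ := by
  refine ⟨(h δ).2 le_rfl, ?_⟩
  rintro ⟨ε', δ', hlt | hlt, hQ⟩
  · obtain rfl : ε' = 0 := le_antisymm hlt.1 (zero_le)
    exact absurd ((h δ').1 hQ) (not_le.2 hlt.2)
  · exact not_lt_zero hlt.1

/-- The probability that the law `p` gives to the set `S`, as a real number. -/
def prob {R : Type*} (p : PMF R) (S : Set R) : ℝ := (p.toOuterMeasure S).toReal

theorem toOuterMeasure_ne_top {R : Type*} (p : PMF R) (S : Set R) : p.toOuterMeasure S ≠ ∞ := by
  rw [PMF.toOuterMeasure_apply]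
  exact p.tsum_coe_indicator_ne_top S

theorem toOuterMeasure_le_add_iff {R : Type*} (p q : PMF R) (S : Set R) (δ : ℝ≥0) :
    p.toOuterMeasure S ≤ q.toOuterMeasure S + δ ↔ prob p S ≤ prob q S + δ := by
  rw [prob, prob, ← ENNReal.toReal_le_toReal (toOuterMeasure_ne_top p S)
    (ENNReal.add_ne_top.2 ⟨toOuterMeasure_ne_top q S, ENNReal.coe_ne_top⟩),
    ENNReal.toReal_add (toOuterMeasure_ne_top q S) ENNReal.coe_ne_top, ENNReal.coe_toReal]

theorem prob_eq_sum (p : PMF R) (S : Set R) :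
    prob p S = ∑ b, S.indicator (fun b => (p b).toReal) b := by
  rw [prob, PMF.toOuterMeasure_apply_fintype, ENNReal.toReal_sum]
  · refine Finset.sum_congr rfl fun b _ => ?_
    by_cases hb : b ∈ S <;> simp [hb]
  · intro b _
    by_cases hb : b ∈ S <;> simp [hb, p.apply_ne_top]

theorem toReal_mem_stdSimplex (p : PMF R) : (fun b => (p b).toReal) ∈ stdSimplex ℝ R := by
  refine ⟨fun b => ENNReal.toReal_nonneg, ?_⟩
  rw [← ENNReal.toReal_sum fun b _ => p.apply_ne_top b,
    ← tsum_fintype (L := .unconditional _), p.tsum_coe,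
    ENNReal.toReal_one]

theorem exists_pmf_toReal_eq {v : R → ℝ} (hv : v ∈ stdSimplex ℝ R) :
    ∃ p : PMF R, ∀ b, (p b).toReal = v b := by
  refine ⟨PMF.ofFintype (fun b => ENNReal.ofReal (v b)) ?_, fun b => ?_⟩
  · rw [← ENNReal.ofReal_sum_of_nonneg fun b _ => hv.1 b, hv.2, ENNReal.ofReal_one]
  · rw [PMF.ofFintype_apply, ENNReal.toReal_ofReal (hv.1 b)]

/-- The largest change of the probability of an event between two members of a family of laws. -/
def pairwiseOptimum (μ : ι → PMF R) : ℝ≥0 := by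
  classical
  exact Finset.univ.sup fun t : ι × ι × Set R =>
    (prob (μ t.1) t.2.2 - prob (μ t.2.1) t.2.2).toNNReal

theorem pairwiseOptimum_le_iff (μ : ι → PMF R) (δ : ℝ≥0) :
    pairwiseOptimum μ ≤ δ ↔
      ∀ x x' S, (μ x).toOuterMeasure S ≤ (μ x').toOuterMeasure S + δ := by
  simp only [pairwiseOptimum, Finset.sup_le_iff, Finset.mem_univ, true_imp_iff, Prod.forall,
    Real.toNNReal_le_iff_le_coe, sub_le_iff_le_add', toOuterMeasure_le_add_iff]

/-- The worst discrepancy is a maximum of finitely many continuous functions of the simulated law,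
so it attains its minimum on the compact simplex. Attainment is what an exact parameter needs. -/
theorem exists_simulator_optimum [Nonempty ι] [Nonempty R] (μ : ι → PMF R) :
    ∃ δ₀ : ℝ≥0, ∀ δ : ℝ≥0, δ₀ ≤ δ ↔ ∃ ν : PMF R, ∀ x S,
      (μ x).toOuterMeasure S ≤ ν.toOuterMeasure S + δ ∧
        ν.toOuterMeasure S ≤ (μ x).toOuterMeasure S + δ := by
  classical
  let φ : (R → ℝ) → ℝ := fun v => (Finset.univ : Finset (ι × Set R)).sup' Finset.univ_nonempty
    fun t => |prob (μ t.1) t.2 - ∑ b, t.2.indicator v b|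
  have hφ : Continuous φ := by
    refine Continuous.finset_sup'_apply _ fun t _ => ?_
    refine (continuous_const.sub (continuous_finsetSum _ fun b _ => ?_)).abs
    by_cases hb : b ∈ t.2
    · simpa [hb] using continuous_apply b
    · simpa [hb] using continuous_const
  have hφ_iff : ∀ (v : R → ℝ) (c : ℝ),
      φ v ≤ c ↔ ∀ x S, |prob (μ x) S - ∑ b, S.indicator v b| ≤ c := by
    intro v c
    simp [φ, Finset.sup'_le_iff]
  obtain ⟨v, hv, hmin⟩ := (isCompact_stdSimplex ℝ R).exists_isMinOn
    ⟨_, toReal_mem_stdSimplex (μ (Classical.arbitrary ι))⟩ hφ.continuousOn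
  have h0 : 0 ≤ φ v :=
    (abs_nonneg _).trans ((hφ_iff v _).1 le_rfl (Classical.arbitrary ι) ∅)
  have hiff : ∀ (ν : PMF R) (δ : ℝ≥0), (∀ x S, (μ x).toOuterMeasure S ≤ ν.toOuterMeasure S + δ ∧
      ν.toOuterMeasure S ≤ (μ x).toOuterMeasure S + δ) ↔ φ (fun b => (ν b).toReal) ≤ δ := by
    intro ν δ
    rw [hφ_iff]
    refine forall₂_congr fun x S => ?_
    rw [toOuterMeasure_le_add_iff, toOuterMeasure_le_add_iff, ← prob_eq_sum, abs_le]
    constructor <;> rintro ⟨h1, h2⟩ <;> constructor <;> linarith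
  refine ⟨⟨φ v, h0⟩, fun δ => ?_⟩
  simp only [hiff]
  constructor
  · intro h
    obtain ⟨ν, hν⟩ := exists_pmf_toReal_eq hv
    refine ⟨ν, ?_⟩
    rw [show (fun b => (ν b).toReal) = v from funext hν]
    exact_mod_cast h
  · rintro ⟨ν, hν⟩
    have : φ v ≤ δ := (hmin (toReal_mem_stdSimplex ν)).trans hν
    exact_mod_cast this

theorem exists_simulator_of_pairwiseOptimum_le [Nonempty ι] {μ : ι → PMF R} {δ : ℝ≥0}
    (h : pairwiseOptimum μ ≤ δ) :
    ∃ ν : PMF R, ∀ x S, (μ x).toOuterMeasure S ≤ ν.toOuterMeasure S + δ ∧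
      ν.toOuterMeasure S ≤ (μ x).toOuterMeasure S + δ := by
  rw [pairwiseOptimum_le_iff] at h
  exact ⟨μ (Classical.arbitrary ι), fun x S => ⟨h _ _ S, h _ _ S⟩⟩

theorem pairwiseOptimum_le_two_mul {μ : ι → PMF R} {δ : ℝ≥0} (h : ∃ ν : PMF R, ∀ x S,
    (μ x).toOuterMeasure S ≤ ν.toOuterMeasure S + δ ∧
      ν.toOuterMeasure S ≤ (μ x).toOuterMeasure S + δ) :
    pairwiseOptimum μ ≤ 2 * δ := by
  obtain ⟨ν, hν⟩ := h
  rw [pairwiseOptimum_le_iff]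
  intro x x' S
  refine ((hν x S).1.trans (add_le_add_left (hν x' S).2 _)).trans (le_of_eq ?_)
  push_cast
  ring

end Optimum

/-! ### Expectations over i.i.d. databases -/

section Expectation

variable {U : Type*} [Fintype U]

/-- The expectation of `f` over `n` i.i.d. rows with weights `p`. -/
def expect (p : U → ℝ) (n : ℕ) (f : (Fin n → U) → ℝ) : ℝ :=
  ∑ d, (∏ j, p (d j)) * f d

theorem expect_succ (p : U → ℝ) {n : ℕ} (i : Fin (n + 1)) (f : (Fin (n + 1) → U) → ℝ) :
    expect p (n + 1) f = ∑ u, p u * expect p n fun d => f (i.insertNth u d) := by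
  rw [expect, ← (Fin.insertNthEquiv (fun _ => U) i).sum_comp, Fintype.sum_prod_type]
  refine Finset.sum_congr rfl fun u _ => ?_
  rw [expect, Finset.mul_sum]
  refine Finset.sum_congr rfl fun d _ => ?_
  rw [Fin.prod_univ_succAbove _ i]
  simp only [Fin.insertNthEquiv_apply, Fin.insertNth_apply_same, Fin.insertNth_apply_succAbove,
    mul_assoc]
  rfl

theorem expect_add (p : U → ℝ) (n : ℕ) (f g : (Fin n → U) → ℝ) :
    (expect p n fun d => f d + g d) = expect p n f + expect p n g := by
  simp [expect, mul_add, Finset.sum_add_distrib]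

theorem expect_sub (p : U → ℝ) (n : ℕ) (f g : (Fin n → U) → ℝ) :
    (expect p n fun d => f d - g d) = expect p n f - expect p n g := by
  simp [expect, mul_sub, Finset.sum_sub_distrib]

theorem expect_const_mul (p : U → ℝ) (n : ℕ) (c : ℝ) (f : (Fin n → U) → ℝ) :
    (expect p n fun d => c * f d) = c * expect p n f := by
  simp only [expect, Finset.mul_sum]
  exact Finset.sum_congr rfl fun d _ => by ring

theorem expect_sum {ι : Type*} (p : U → ℝ) (n : ℕ) (s : Finset ι) (f : ι → (Fin n → U) → ℝ) :
    (expect p n fun d => ∑ i ∈ s, f i d) = ∑ i ∈ s, expect p n (f i) := by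
  simp only [expect, Finset.mul_sum]
  exact Finset.sum_comm

theorem expect_prod (p : U → ℝ) (n : ℕ) (g : U → ℝ) :
    (expect p n fun d => ∏ j, g (d j)) = (∑ u, p u * g u) ^ n := by
  simp only [expect, ← Finset.prod_mul_distrib]
  exact (Fintype.sum_pow (fun u => p u * g u) n).symm

theorem expect_mono {p : U → ℝ} (hp : ∀ u, 0 ≤ p u) (n : ℕ) {f g : (Fin n → U) → ℝ}
    (h : ∀ d, f d ≤ g d) : expect p n f ≤ expect p n g :=
  Finset.sum_le_sum fun d _ =>
    mul_le_mul_of_nonneg_left (h d) (Finset.prod_nonneg fun j _ => hp (d j))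

theorem expect_const {p : U → ℝ} (hp : ∑ u, p u = 1) (n : ℕ) (c : ℝ) :
    (expect p n fun _ => c) = c := by
  have h1 := expect_prod p n fun _ => 1
  simp only [Finset.prod_const_one, mul_one, hp, one_pow] at h1
  have h2 := expect_const_mul p n c fun _ => 1
  rw [h1, mul_one] at h2
  simpa using h2

theorem expect_sum_apply {p : U → ℝ} (hp : ∑ u, p u = 1) {f : U → ℝ} (hf : ∑ u, p u * f u = 0)
    (n : ℕ) : (expect p n fun d => ∑ i, f (d i)) = 0 := by
  induction n with
  | zero => simp [expect]
  | succ n ih =>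
    rw [expect_succ p 0]
    simp only [Fin.sum_univ_succ, Fin.insertNth_zero', Fin.cons_zero, Fin.cons_succ]
    simp only [expect_add, ih, expect_const hp, add_zero, hf]

theorem expect_sq_sum {p : U → ℝ} (hp : ∑ u, p u = 1) {f : U → ℝ} (hf : ∑ u, p u * f u = 0)
    (n : ℕ) : (expect p n fun d => (∑ i, f (d i)) ^ 2) = n * ∑ u, p u * f u ^ 2 := by
  induction n with
  | zero => simp [expect]
  | succ n ih =>
    rw [expect_succ p 0]
    simp only [Fin.sum_univ_succ, Fin.insertNth_zero', Fin.cons_zero, Fin.cons_succ]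
    have h : ∀ u, (expect p n fun d => (f u + ∑ i, f (d i)) ^ 2) =
        f u ^ 2 + n * ∑ u, p u * f u ^ 2 := by
      intro u
      have h1 : (fun d : Fin n → U => (f u + ∑ i, f (d i)) ^ 2) =
          fun d => (f u ^ 2 + 2 * f u * ∑ i, f (d i)) + (∑ i, f (d i)) ^ 2 := by
        funext d
        ring
      rw [h1, expect_add, expect_add, expect_const hp, expect_const_mul, expect_sum_apply hp hf, ih]
      ring
    simp only [h, mul_add, Finset.sum_add_distrib, ← Finset.sum_mul, hp]
    push_cast
    ring

end Expectation

/-! ### The output law of a voting rule -/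

section Voting

variable {m : ℕ}

theorem hist_perm {l l' : List (Ranking m)} (h : l.Perm l') : hist l = hist l' :=
  funext fun V => h.count_eq V

theorem mechanism_perm (r : GSR m) (l l' : List (Ranking m)) (h : l.Perm l') :
    r.mechanism l = r.mechanism l' := by
  rw [GSR.mechanism, GSR.mechanism, hist_perm h]

theorem hist_cons (x : Ranking m) (l : List (Ranking m)) :
    hist (x :: l) = hist l + Pi.single x 1 := by
  funext V
  rw [hist, List.count_cons, Pi.add_apply, Pi.single_apply]
  simp only [hist, beq_iff_eq, eq_comm (a := V)]

theorem hist_ofFn {n : ℕ} (d : Fin n → Ranking m) (V : Ranking m) :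
    hist (List.ofFn d) V = ∑ i, if d i = V then 1 else 0 := by
  induction n with
  | zero => simp [hist]
  | succ n ih =>
    rw [List.ofFn_succ, hist_cons, Pi.add_apply, ih, Fin.sum_univ_succ, add_comm, Pi.single_apply]
    simp only [eq_comm]

theorem hist_ofFn_insertNth {n : ℕ} (i : Fin (n + 1)) (x : Ranking m) (d : Fin n → Ranking m) :
    hist (List.ofFn (i.insertNth x d : Fin (n + 1) → Ranking m)) = hist (x :: List.ofFn d) := by
  funext V
  rw [hist_ofFn, Fin.sum_univ_succAbove _ i, hist_cons, Pi.add_apply, hist_ofFn, add_comm,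
    Pi.single_apply]
  simp [eq_comm]

theorem sum_mul_hist (h : Ranking m → ℝ) (l : List (Ranking m)) :
    ∑ V, h V * (hist l V : ℝ) = (l.map h).sum := by
  induction l with
  | nil => simp [hist]
  | cons x l ih =>
    rw [hist_cons, List.map_cons, List.sum_cons, ← ih]
    simp [mul_add, Finset.sum_add_distrib, Pi.single_apply, add_comm]

theorem sum_mul_hist_cons_ofFn (h : Ranking m → ℝ) (x : Ranking m) {n : ℕ}
    (d : Fin n → Ranking m) :
    ∑ V, h V * (hist (x :: List.ofFn d) V : ℝ) = h x + ∑ i, h (d i) := by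
  rw [sum_mul_hist, List.map_cons, List.sum_cons, List.map_ofFn, List.sum_ofFn]
  rfl

theorem prob_rowOutput (r : GSR m) (π : PMF (Ranking m)) (n : ℕ) (x : Ranking m)
    (S : Set (Fin m)) :
    prob (rowOutput r.mechanism π n x) S = expect (fun V => (π V).toReal) n fun d =>
      S.indicator 1 (r.rule (hist (x :: List.ofFn d))) := by
  classical
  rw [prob, rowOutput, iidDatabase, PMF.bind_map, PMF.toOuterMeasure_bind_apply, tsum_fintype,
    ENNReal.toReal_sum, expect]
  · refine Finset.sum_congr rfl fun d _ => ?_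
    rw [PMF.ofFintype_apply, ENNReal.toReal_mul, ENNReal.toReal_prod, Function.comp_apply,
      GSR.mechanism, PMF.toOuterMeasure_pure_apply, Set.indicator_apply]
    congr 1
    split_ifs <;> simp
  · intro d _
    rw [PMF.ofFintype_apply]
    exact ENNReal.mul_ne_top (ENNReal.prod_ne_top fun i _ => π.apply_ne_top _)
      (toOuterMeasure_ne_top _ _)

theorem sum_toReal_eq_one {U : Type*} [Fintype U] (π : PMF U) : ∑ u, (π u).toReal = 1 :=
  (toReal_mem_stdSimplex π).2

/-- Exchangeability: each of the `n + 1` rows contributes the same amount to the expected number of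
`x` votes weighted by the indicator of `S`. This turns a conditional probability into an
unconditional expectation, in which different `x` can be compared. -/
theorem mul_prob_rowOutput (r : GSR m) (π : PMF (Ranking m)) (n : ℕ) (x : Ranking m)
    (S : Set (Fin m)) :
    (n + 1) * ((π x).toReal * prob (rowOutput r.mechanism π n x) S) =
      expect (fun V => (π V).toReal) (n + 1) fun d =>
        (∑ i, if d i = x then 1 else 0) * S.indicator 1 (r.rule (hist (List.ofFn d))) := by
  simp only [Finset.sum_mul]
  rw [expect_sum]
  have h : ∀ i : Fin (n + 1), (expect (fun V => (π V).toReal) (n + 1) fun d =>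
      (if d i = x then 1 else 0) * S.indicator 1 (r.rule (hist (List.ofFn d)))) =
      (π x).toReal * prob (rowOutput r.mechanism π n x) S := by
    intro i
    rw [expect_succ _ i, Finset.sum_eq_single x, prob_rowOutput]
    · simp only [Fin.insertNth_apply_same, hist_ofFn_insertNth, if_true, one_mul]
    · intro u _ hu
      simp only [Fin.insertNth_apply_same, if_neg hu, zero_mul]
      rw [expect_const (sum_toReal_eq_one π), mul_zero]
    · simp
  rw [Finset.sum_congr rfl fun i _ => h i]
  simp

/-! ### The bound of order `1 / √n` -/

theorem exists_prob_rowOutput_sub_le_div_sqrt (r : GSR m) {π : PMF (Ranking m)}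
    (hπ : ∀ V, 0 < π V) (x x' : Ranking m) :
    ∃ C : ℝ, 0 ≤ C ∧ ∀ n S, prob (rowOutput r.mechanism π n x) S -
      prob (rowOutput r.mechanism π n x') S ≤ C / √(n + 1) := by
  set p : Ranking m → ℝ := fun V => (π V).toReal with hp
  have hp0 : ∀ V, 0 < p V := fun V => ENNReal.toReal_pos (hπ V).ne' (π.apply_ne_top V)
  have hp1 : ∑ V, p V = 1 := sum_toReal_eq_one π
  -- The weights make `f` centred under `π`, so the sum of `f` over `n + 1` votes has variance `(n +
  -- 1) * σ`.
  set f : Ranking m → ℝ := fun V =>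
    (if V = x then 1 else 0) / p x - (if V = x' then 1 else 0) / p x' with hf
  have hf0 : ∑ V, p V * f V = 0 := by
    simp only [hf, mul_sub, Finset.sum_sub_distrib, mul_div_assoc', ← Finset.sum_div]
    simp [(hp0 x).ne', (hp0 x').ne']
  set σ : ℝ := ∑ V, p V * f V ^ 2 with hσ
  have hσ0 : 0 ≤ σ := Finset.sum_nonneg fun V _ => mul_nonneg (hp0 V).le (sq_nonneg _)
  refine ⟨(σ + 1) / 2, by positivity, fun n S => ?_⟩
  have hn : (0 : ℝ) < n + 1 := by positivity
  set s : ℝ := √(n + 1) with hs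
  have hs0 : 0 < s := Real.sqrt_pos.2 hn
  have hs2 : s ^ 2 = n + 1 := Real.sq_sqrt hn.le
  have hrepr : ∀ y, prob (rowOutput r.mechanism π n y) S = expect p (n + 1) fun d =>
      (1 / ((n + 1) * p y)) * ((∑ i, if d i = y then 1 else 0) *
        S.indicator 1 (r.rule (hist (List.ofFn d)))) := by
    intro y
    rw [expect_const_mul, ← mul_prob_rowOutput]
    have := (hp0 y).ne'
    simp only [hp] at this ⊢
    field_simp
  rw [hrepr x, hrepr x', ← expect_sub]
  -- With `z` the centred sum and `b ∈ {0, 1}` the indicator, this is `2 * s * b * z ≤ z ^ 2 + s ^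
  -- 2` divided by `2 * s ^ 3`. Since `z` is typically of order `s`, both terms on the right then
  -- have mean of order `1 / s`.
  have hpt : ∀ d : Fin (n + 1) → Ranking m,
      (1 / ((n + 1) * p x)) * ((∑ i, if d i = x then 1 else 0) *
        S.indicator 1 (r.rule (hist (List.ofFn d)))) -
      (1 / ((n + 1) * p x')) * ((∑ i, if d i = x' then 1 else 0) *
        S.indicator 1 (r.rule (hist (List.ofFn d)))) ≤
      1 / (2 * s ^ 3) * (∑ i, f (d i)) ^ 2 + 1 / (2 * s) := by
    intro d
    set b : ℝ := S.indicator 1 (r.rule (hist (List.ofFn d))) with hb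
    have hb01 : b = 0 ∨ b = 1 := by
      rw [hb]
      by_cases h : r.rule (hist (List.ofFn d)) ∈ S
      · exact Or.inr (Set.indicator_of_mem h _)
      · exact Or.inl (Set.indicator_of_notMem h _)
    have hsum : ∑ i, f (d i) = (∑ i, if d i = x then 1 else 0) / p x -
        (∑ i, if d i = x' then 1 else 0) / p x' := by
      simp only [hf, Finset.sum_sub_distrib, Finset.sum_div]
    have hL : (1 / ((n + 1) * p x)) * ((∑ i, if d i = x then 1 else 0) * b) -
        (1 / ((n + 1) * p x')) * ((∑ i, if d i = x' then 1 else 0) * b) =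
        b * (∑ i, f (d i)) / s ^ 2 := by
      rw [hsum, hs2]
      have h1 := (hp0 x).ne'
      have h2 := (hp0 x').ne'
      field_simp
    rw [hL]
    set z : ℝ := ∑ i, f (d i)
    have hR : 1 / (2 * s ^ 3) * z ^ 2 + 1 / (2 * s) - b * z / s ^ 2 =
        (z ^ 2 + s ^ 2 - 2 * s * (b * z)) / (2 * s ^ 3) := by
      field_simp
    have : 0 ≤ 1 / (2 * s ^ 3) * z ^ 2 + 1 / (2 * s) - b * z / s ^ 2 := by
      rw [hR]
      apply div_nonneg _ (by positivity)
      rcases hb01 with h | h <;> rw [h]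
      · nlinarith [sq_nonneg z, sq_nonneg s]
      · nlinarith [sq_nonneg (z - s)]
    linarith
  refine (expect_mono (fun V => (hp0 V).le) _ hpt).trans (le_of_eq ?_)
  rw [expect_add, expect_const_mul, expect_sq_sum hp1 hf0, expect_const hp1, ← hσ]
  push_cast
  rw [← hs2]
  field_simp

theorem exists_pairwiseOptimum_le_div_sqrt (r : GSR m) {π : PMF (Ranking m)}
    (hπ : ∀ V, 0 < π V) :
    ∃ C : ℝ, ∀ n, (pairwiseOptimum (rowOutput r.mechanism π n) : ℝ) ≤ C / √(n + 1) := by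
  choose C hC0 hC using exists_prob_rowOutput_sub_le_div_sqrt r hπ
  refine ⟨∑ x, ∑ x', C x x', fun n => ?_⟩
  have h0 : 0 ≤ ∑ x, ∑ x', C x x' :=
    Finset.sum_nonneg fun x _ => Finset.sum_nonneg fun x' _ => hC0 x x'
  have hle : ∀ x x', C x x' ≤ ∑ x, ∑ x', C x x' := fun x x' =>
    (Finset.single_le_sum (fun x' _ => hC0 x x') (Finset.mem_univ x')).trans
      (Finset.single_le_sum (f := fun x => ∑ x', C x x')
        (fun x _ => Finset.sum_nonneg fun x' _ => hC0 x x') (Finset.mem_univ x))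
  have := (pairwiseOptimum_le_iff (rowOutput r.mechanism π n)
    ((∑ x, ∑ x', C x x') / √(n + 1)).toNNReal).2 fun x x' S => by
      rw [toOuterMeasure_le_add_iff, Real.coe_toNNReal _ (by positivity)]
      have h1 := hC x x' n S
      have h2 : C x x' / √((n : ℝ) + 1) ≤ (∑ x, ∑ x', C x x') / √((n : ℝ) + 1) := by
        gcongr
        exact hle x x'
      linarith
  exact (Real.le_toNNReal_iff_coe_le (by positivity)).1 this

end Voting

/-! ### The exponential bound -/

theorem sum_mul_exp_neg_le {U : Type*} [Fintype U] {p y : U → ℝ} (hp0 : ∀ u, 0 ≤ p u)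
    (hp1 : ∑ u, p u = 1) (hy : ∀ u, |y u| ≤ 1) {q : ℝ} (hq : ∑ u, p u * y u ^ 2 ≤ q) {t : ℝ}
    (ht0 : 0 ≤ t) (ht1 : t ≤ 1) :
    ∑ u, p u * Real.exp (-(t * y u)) ≤ 1 - t * (∑ u, p u * y u) + t ^ 2 * q := by
  have h : ∀ u, p u * Real.exp (-(t * y u)) ≤
      p u - t * (p u * y u) + t ^ 2 * (p u * y u ^ 2) := by
    intro u
    have habs : |-(t * y u)| ≤ 1 := by
      rw [abs_neg, abs_mul, abs_of_nonneg ht0]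
      exact mul_le_one₀ ht1 (abs_nonneg _) (hy u)
    have h1 := (abs_le.1 (Real.abs_exp_sub_one_sub_id_le habs)).2
    have h2 : Real.exp (-(t * y u)) ≤ 1 - t * y u + t ^ 2 * y u ^ 2 := by nlinarith
    calc p u * Real.exp (-(t * y u)) ≤ p u * (1 - t * y u + t ^ 2 * y u ^ 2) :=
          mul_le_mul_of_nonneg_left h2 (hp0 u)
      _ = _ := by ring
  refine (Finset.sum_le_sum fun u _ => h u).trans ?_
  rw [Finset.sum_add_distrib, Finset.sum_sub_distrib, ← Finset.mul_sum, ← Finset.mul_sum, hp1]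
  gcongr

/-- Chooses the Chernoff parameter `t`. The unconstrained minimizer `d / (2 * q)` may exceed `1` for
small `q`, so a fixed multiple of `d` replaces it there. The constant `3` in the exponent leaves
room for this, together with `k * q ≥ 1` or, in the middle range, `k * q ≥ 4 / 3`. -/
theorem exists_quadratic_le_exp {d q k : ℝ} (hd0 : 0 ≤ d) (hd1 : d ≤ 1) (hq0 : 0 < q)
    (hk : 2 ≤ k) (hkq : 1 ≤ k * q) :
    ∃ t, 0 ≤ t ∧ t ≤ 1 ∧ 1 - t * d + t ^ 2 * q ≤ Real.exp (-(d ^ 2 / (3 * k * q))) := by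
  have hexp := Real.add_one_le_exp (-(d ^ 2 / (3 * k * q)))
  have hpos : 0 < 3 * k * q := by positivity
  by_cases hq : q ≤ 2 / 3
  · refine ⟨3 * d / 4, by positivity, by linarith, le_trans ?_ hexp⟩
    have h1 : d ^ 2 / (3 * k * q) ≤ 3 / 8 * d ^ 2 := by
      rw [div_le_iff₀ hpos]
      nlinarith [mul_nonneg (sq_nonneg d) (sub_nonneg.2 hkq)]
    nlinarith [mul_nonneg (sq_nonneg d) (sub_nonneg.2 hq)]
  · push Not at hq
    by_cases hq1 : q ≤ 1
    · refine ⟨d / 2, by positivity, by linarith, le_trans ?_ hexp⟩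
      have h1 : d ^ 2 / (3 * k * q) ≤ 1 / 4 * d ^ 2 := by
        rw [div_le_iff₀ hpos]
        have : 4 / 3 ≤ k * q := by nlinarith
        nlinarith [mul_nonneg (sq_nonneg d) (sub_nonneg.2 this)]
      nlinarith [mul_nonneg (sq_nonneg d) (sub_nonneg.2 hq1)]
    · push Not at hq1
      refine ⟨d / (2 * q), by positivity, ?_, le_trans ?_ hexp⟩
      · rw [div_le_one (by positivity)]
        linarith
      · have h1 : 1 - d / (2 * q) * d + (d / (2 * q)) ^ 2 * q = 1 - d ^ 2 / (4 * q) := by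
          field_simp
          ring
        have h2 : d ^ 2 / (3 * k * q) ≤ d ^ 2 / (4 * q) := by
          apply div_le_div_of_nonneg_left (sq_nonneg d) (by positivity)
          nlinarith
        linarith

/-- Chernoff's method. The fixed vote `x` costs at most the factor `Real.exp 1`, since `t * y x ≥
-1`. -/
theorem expect_sum_nonpos_le {U : Type*} [Fintype U] {p y : U → ℝ} (hp0 : ∀ u, 0 ≤ p u)
    (hp1 : ∑ u, p u = 1) (hy : ∀ u, |y u| ≤ 1) {q k : ℝ} (hq : ∑ u, p u * y u ^ 2 ≤ q)
    (hq0 : 0 < q) (hk : 2 ≤ k) (hkq : 1 ≤ k * q) (hd0 : 0 ≤ ∑ u, p u * y u) (x : U) (n : ℕ) :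
    (expect p n fun d => {z : ℝ | z ≤ 0}.indicator 1 (y x + ∑ i, y (d i))) ≤
      Real.exp 1 * Real.exp (-((∑ u, p u * y u) ^ 2 / (3 * k * q)) * n) := by
  have hd1 : ∑ u, p u * y u ≤ 1 := by
    rw [← hp1]
    exact Finset.sum_le_sum fun u _ =>
      mul_le_of_le_one_right (hp0 u) ((le_abs_self _).trans (hy u))
  obtain ⟨t, ht0, ht1, ht⟩ := exists_quadratic_le_exp hd0 hd1 hq0 hk hkq
  have hpt : ∀ d : Fin n → U, {z : ℝ | z ≤ 0}.indicator 1 (y x + ∑ i, y (d i)) ≤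
      Real.exp 1 * ∏ i, Real.exp (-(t * y (d i))) := by
    intro d
    by_cases h : y x + ∑ i, y (d i) ≤ 0
    · rw [Set.indicator_of_mem (show _ ∈ {z : ℝ | z ≤ 0} from h), Pi.one_apply, ← Real.exp_sum,
        ← Real.exp_add, Real.one_le_exp_iff]
      rw [Finset.sum_neg_distrib, ← Finset.mul_sum]
      have := (abs_le.1 (hy x)).1
      nlinarith
    · rw [Set.indicator_of_notMem (show _ ∉ {z : ℝ | z ≤ 0} from h)]
      positivity
  refine (expect_mono hp0 n hpt).trans ?_
  rw [expect_const_mul, expect_prod p n fun u => Real.exp (-(t * y u)), mul_comm _ (n : ℝ),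
    Real.exp_nat_mul]
  gcongr
  · exact Finset.sum_nonneg fun u _ => mul_nonneg (hp0 u) (Real.exp_pos _).le
  · exact (sum_mul_exp_neg_le hp0 hp1 hy hq ht0 ht1).trans ht

section Voting

variable {m : ℕ}

theorem sum_sq_pos {ι : Type*} [Fintype ι] {h : ι → ℝ} (hh : h ≠ 0) : 0 < ∑ i, h i ^ 2 := by
  obtain ⟨i, hi⟩ := Function.ne_iff.1 hh
  exact Finset.sum_pos' (fun i _ => sq_nonneg _) ⟨i, Finset.mem_univ i, sq_pos_of_ne_zero hi⟩

theorem sign_eq_of_pos_mul {a b : ℝ} (h : 0 < a * b) : SignType.sign a = SignType.sign b := by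
  rcases pos_and_pos_or_neg_and_neg_of_mul_pos h with ⟨ha, hb⟩ | ⟨ha, hb⟩
  · rw [sign_pos ha, sign_pos hb]
  · rw [sign_neg ha, sign_neg hb]

/-- The probability that a random profile falls on the wrong side of a hyperplane. -/
theorem expect_sign_ne_le (hm : 2 ≤ m) (π : PMF (Ranking m)) {h : Ranking m → ℝ} (hh : h ≠ 0)
    (hdist : 0 < hyperplaneDist (fun V => (π V).toReal) h) (x : Ranking m) (n : ℕ) :
    (expect (fun V => (π V).toReal) n fun d =>
      {s | s ≠ SignType.sign (∑ V, h V * (π V).toReal)}.indicator 1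
      (SignType.sign (∑ V, h V * (hist (x :: List.ofFn d) V : ℝ)))) ≤
    Real.exp 1 * Real.exp (-((hyperplaneDist (fun V => (π V).toReal) h) ^ 2 /
      (3 * (m.factorial : ℝ) * ⨆ V, (π V).toReal)) * n) := by
  set p : Ranking m → ℝ := fun V => (π V).toReal with hp
  have hp0 : ∀ V, 0 ≤ p V := fun V => ENNReal.toReal_nonneg
  have hp1 : ∑ V, p V = 1 := sum_toReal_eq_one π
  have hle : ∀ V, p V ≤ ⨆ V, p V := le_ciSup (Set.finite_range p).bddAbove
  have hkq : 1 ≤ (m.factorial : ℝ) * ⨆ V, p V := by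
    calc (1 : ℝ) = ∑ V, p V := hp1.symm
      _ ≤ ∑ _V : Ranking m, ⨆ V, p V := Finset.sum_le_sum fun V _ => hle V
      _ = _ := by simp [Fintype.card_perm]
  have hk : (2 : ℝ) ≤ m.factorial := by
    exact_mod_cast hm.trans (Nat.self_le_factorial m)
  have hq0 : 0 < ⨆ V, p V := by
    by_contra hneg
    push Not at hneg
    nlinarith
  set L : ℝ := √(∑ V, h V ^ 2) with hL
  have hL0 : 0 < L := Real.sqrt_pos.2 (sum_sq_pos hh)
  have hL2 : L ^ 2 = ∑ V, h V ^ 2 := Real.sq_sqrt (sum_sq_pos hh).le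
  set c : ℝ := ∑ V, p V * h V with hc
  have hc' : ∑ V, h V * p V = c := Finset.sum_congr rfl fun V _ => mul_comm _ _
  have hc0 : c ≠ 0 := by
    intro h0
    rw [hyperplaneDist, ← hc, h0] at hdist
    simp at hdist
  set e : ℝ := ((SignType.sign c : SignType) : ℝ) with he
  have hec : e * c = |c| := sign_mul_self c
  have he2 : e ^ 2 = 1 := by
    rcases lt_or_gt_of_ne hc0 with h | h
    · simp [he, sign_neg h]
    · simp [he, sign_pos h]
  -- The unit normal, oriented so that `π` lies on its positive side. Its mean under `π` is the
  -- distance to the hyperplane, and its second moment is at most the largest probability because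
  -- its squares sum to `1`.
  set y : Ranking m → ℝ := fun V => e * h V / L with hy
  have hy2 : ∀ V, y V ^ 2 = h V ^ 2 / L ^ 2 := by
    intro V
    rw [hy, div_pow, mul_pow, he2, one_mul]
  have hysum : ∑ V, y V ^ 2 = 1 := by
    simp only [hy2]
    rw [← Finset.sum_div, ← hL2, div_self (by positivity)]
  have hy1 : ∀ V, |y V| ≤ 1 := by
    intro V
    rw [← sq_le_one_iff_abs_le_one, ← hysum]
    exact Finset.single_le_sum (f := fun V => y V ^ 2) (fun V _ => sq_nonneg _) (Finset.mem_univ V)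
  have hq : ∑ V, p V * y V ^ 2 ≤ ⨆ V, p V := by
    calc ∑ V, p V * y V ^ 2 ≤ ∑ V, (⨆ V, p V) * y V ^ 2 :=
          Finset.sum_le_sum fun V _ => mul_le_mul_of_nonneg_right (hle V) (sq_nonneg _)
      _ = _ := by rw [← Finset.mul_sum, hysum, mul_one]
  have hdy : ∑ V, p V * y V = hyperplaneDist p h := by
    have : ∀ V, p V * y V = e / L * (p V * h V) := fun V => by
      rw [hy]
      ring
    simp only [this]
    rw [← Finset.mul_sum, ← hc, div_mul_eq_mul_div, hec, hyperplaneDist]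
  rw [← hdy] at hdist ⊢
  refine le_trans (expect_mono hp0 n fun d => ?_)
    (expect_sum_nonpos_le hp0 hp1 hy1 hq hq0 hk hkq hdist.le x n)
  rw [sum_mul_hist_cons_ofFn, hc']
  by_cases hpos : y x + ∑ i, y (d i) ≤ 0
  · rw [Set.indicator_of_mem (show _ ∈ {z : ℝ | z ≤ 0} from hpos)]
    exact Set.indicator_le_self' (fun _ _ => zero_le_one) _
  · rw [Set.indicator_of_notMem (show _ ∉ {z : ℝ | z ≤ 0} from hpos), Set.indicator_of_notMem]
    simp only [Set.mem_ofPred_eq, not_not]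
    push Not at hpos
    have hs : y x + ∑ i, y (d i) = e * (h x + ∑ i, h (d i)) / L := by
      simp only [hy]
      rw [← Finset.sum_div, ← Finset.mul_sum, ← add_div, mul_add]
    rw [hs] at hpos
    have hpos' : 0 < e * (h x + ∑ i, h (d i)) := (div_pos_iff_of_pos_right hL0).1 hpos
    apply sign_eq_of_pos_mul
    have : (h x + ∑ i, h (d i)) * c = (e * (h x + ∑ i, h (d i))) * |c| := by
      rw [← hec]
      linear_combination (-(h x + ∑ i, h (d i)) * c) * he2
    rw [this]
    exact mul_pos hpos' (abs_pos.2 hc0)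

theorem pairwiseOptimum_le_one (r : GSR m) (π : PMF (Ranking m)) (n : ℕ) :
    pairwiseOptimum (rowOutput r.mechanism π n) ≤ 1 := by
  rw [pairwiseOptimum_le_iff]
  intro x x' S
  refine le_trans ?_ le_add_self
  rw [PMF.toOuterMeasure_apply, ENNReal.coe_one, ← (rowOutput r.mechanism π n x).tsum_coe]
  exact ENNReal.tsum_le_tsum fun b => Set.indicator_le_self _ _ b

theorem rule_eq_of_sign_eq (r : GSR m) {P : Ranking m → ℕ} {p : Ranking m → ℝ}
    (h : ∀ j, SignType.sign (∑ V, r.h j V * (P V : ℝ)) = SignType.sign (∑ V, r.h j V * p V)) :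
    r.rule P = r.winner p :=
  congrArg r.g (funext h)

theorem pairwiseOptimum_le_exp (hm : 2 ≤ m) (r : GSR m) (π : PMF (Ranking m)) :
    ∃ C : ℝ, ∀ n : ℕ, (pairwiseOptimum (rowOutput r.mechanism π n) : ℝ) ≤ C *
      Real.exp (-((⨅ j, hyperplaneDist (fun V => (π V).toReal) (r.h j)) ^ 2 /
        (3 * (m.factorial : ℝ) * ⨆ V, (π V).toReal)) * (n + 1 : ℕ)) := by
  set p : Ranking m → ℝ := fun V => (π V).toReal with hp
  have hp0 : ∀ V, 0 ≤ p V := fun V => ENNReal.toReal_nonneg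
  have hdist0 : ∀ j, 0 ≤ hyperplaneDist p (r.h j) := fun j => by
    unfold hyperplaneDist
    positivity
  set D : ℝ := ⨅ j, hyperplaneDist p (r.h j) with hD
  have hD0 : 0 ≤ D := Real.iInf_nonneg hdist0
  have hDle : ∀ j, D ≤ hyperplaneDist p (r.h j) := ciInf_le (Set.finite_range _).bddBelow
  set κ : ℝ := 3 * (m.factorial : ℝ) * ⨆ V, p V with hκ
  have hκ0 : 0 ≤ κ := mul_nonneg (by positivity) (Real.iSup_nonneg hp0)
  -- At distance zero the exponential equals `1` and the trivial bound suffices. A rule with no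
  -- hyperplanes falls here too, the real infimum over an empty index being `0`.
  rcases hD0.eq_or_lt with h0 | hDpos
  · refine ⟨1, fun n => ?_⟩
    rw [← h0]
    simpa using pairwiseOptimum_le_one r π n
  set c : ℝ := D ^ 2 / κ with hc
  -- The factor `2` counts the two fixed votes, `r.R` is the union bound over hyperplanes, `Real.exp
  -- 1` comes from the fixed vote, and `Real.exp c` compensates for only `n` of the `n + 1` rows
  -- being random.
  refine ⟨2 * r.R * Real.exp 1 * Real.exp c, fun n => ?_⟩
  have hexp : 2 * r.R * Real.exp 1 * Real.exp c * Real.exp (-c * (n + 1 : ℕ)) =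
      2 * (r.R * (Real.exp 1 * Real.exp (-c * n))) := by
    rw [show 2 * r.R * Real.exp 1 * Real.exp c * Real.exp (-c * (n + 1 : ℕ)) =
      2 * (r.R * (Real.exp 1 * (Real.exp c * Real.exp (-c * (n + 1 : ℕ))))) by ring, ← Real.exp_add]
    congr 5
    push_cast
    ring
  rw [hexp]
  set B : ℝ := r.R * (Real.exp 1 * Real.exp (-c * n)) with hB
  have hB0 : 0 ≤ B := by positivity
  set bad : Ranking m → Fin r.R → (Fin n → Ranking m) → ℝ := fun x j d =>
    {s | s ≠ SignType.sign (∑ V, r.h j V * p V)}.indicator 1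
      (SignType.sign (∑ V, r.h j V * (hist (x :: List.ofFn d) V : ℝ))) with hbad
  have hbad0 : ∀ x j d, 0 ≤ bad x j d := fun x j d =>
    Set.indicator_nonneg (fun _ _ => zero_le_one) _
  have hbadle : ∀ x, (expect p n fun d => ∑ j, bad x j d) ≤ B := by
    intro x
    rw [expect_sum]
    calc ∑ j, expect p n (bad x j) ≤ ∑ _j : Fin r.R, Real.exp 1 * Real.exp (-c * n) := by
          refine Finset.sum_le_sum fun j _ => ?_
          refine (expect_sign_ne_le hm π (r.h_ne_zero j) (hDpos.trans_le (hDle j)) x n).trans ?_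
          gcongr
          exact div_le_div_of_nonneg_right (pow_le_pow_left₀ hD0 (hDle j) 2) hκ0
      _ = B := by simp [hB]
  have hrule : ∀ x d, (∀ j, bad x j d = 0) → r.rule (hist (x :: List.ofFn d)) = r.winner p := by
    intro x d h
    refine rule_eq_of_sign_eq r fun j => ?_
    by_contra hne
    have h1 := h j
    rw [hbad] at h1
    simp only at h1
    rw [Set.indicator_of_mem (show _ ∈ {s | s ≠ SignType.sign (∑ V, r.h j V * p V)} from hne)] at h1
    exact one_ne_zero h1
  have hone : ∀ x j d, bad x j d ≠ 0 → bad x j d = 1 := fun x j d h =>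
    Set.indicator_of_mem (Set.mem_of_indicator_ne_zero h) _
  have key : ∀ x x' S, prob (rowOutput r.mechanism π n x) S ≤
      prob (rowOutput r.mechanism π n x') S + 2 * B := by
    intro x x' S
    rw [prob_rowOutput, prob_rowOutput]
    have hpt : ∀ d : Fin n → Ranking m, S.indicator 1 (r.rule (hist (x :: List.ofFn d))) ≤
        S.indicator (1 : Fin m → ℝ) (r.rule (hist (x' :: List.ofFn d))) +
          (∑ j, bad x j d + ∑ j, bad x' j d) := by
      intro d
      have hs : ∀ y, 0 ≤ ∑ j, bad y j d := fun y => Finset.sum_nonneg fun j _ => hbad0 y j d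
      have hi0 : ∀ b, 0 ≤ S.indicator (1 : Fin m → ℝ) b := fun b =>
        Set.indicator_nonneg (fun _ _ => zero_le_one) b
      have hi1 : ∀ b, S.indicator (1 : Fin m → ℝ) b ≤ 1 := fun b =>
        Set.indicator_le_self' (fun _ _ => zero_le_one) b
      have hbig : ∀ y, ¬ (∀ j, bad y j d = 0) → 1 ≤ ∑ j, bad y j d := by
        intro y hy
        push Not at hy
        obtain ⟨j, hj⟩ := hy
        rw [← hone y j d hj]
        exact Finset.single_le_sum (f := fun j => bad y j d) (fun j _ => hbad0 y j d)
          (Finset.mem_univ j)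
      by_cases h1 : ∀ j, bad x j d = 0
      · by_cases h2 : ∀ j, bad x' j d = 0
        · rw [hrule x d h1, hrule x' d h2]
          linarith [hs x, hs x']
        · linarith [hbig x' h2, hs x, hi0 (r.rule (hist (x' :: List.ofFn d))),
            hi1 (r.rule (hist (x :: List.ofFn d)))]
      · linarith [hbig x h1, hs x', hi0 (r.rule (hist (x' :: List.ofFn d))),
            hi1 (r.rule (hist (x :: List.ofFn d)))]
    refine (expect_mono hp0 n hpt).trans ?_
    rw [expect_add, expect_add]
    linarith [hbadle x, hbadle x']
  have := (pairwiseOptimum_le_iff (rowOutput r.mechanism π n) (2 * B).toNNReal).2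
    fun x x' S => by
      rw [toOuterMeasure_le_add_iff, Real.coe_toNNReal _ (by positivity)]
      exact key x x' S
  exact (Real.le_toNNReal_iff_coe_le (by positivity)).1 this

end Voting

/-! ### The probability of a single profile -/

section Multinomial

variable {m : ℕ}

theorem prod_factorial_eq_mul {U : Type*} [Fintype U] [DecidableEq U] {H : U → ℕ} {u : U}
    (hu : H u ≠ 0) :
    ∏ V, (H V).factorial = H u * ∏ V, ((H - Pi.single u 1 : U → ℕ) V).factorial := by
  generalize hG : (H - Pi.single u 1 : U → ℕ) = G
  rw [← Finset.mul_prod_erase _ _ (Finset.mem_univ u),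
    ← Finset.mul_prod_erase _ (fun V => (G V).factorial) (Finset.mem_univ u), ← mul_assoc, ← hG]
  congr 1
  · simp only [Pi.sub_apply, Pi.single_eq_same]
    exact (Nat.mul_factorial_pred hu).symm
  · refine Finset.prod_congr rfl fun V hV => ?_
    simp [Pi.single_eq_of_ne (Finset.ne_of_mem_erase hV)]

theorem add_single_eq_iff {U : Type*} [DecidableEq U] {H G : U → ℕ} {u : U} (hu : H u ≠ 0) :
    G + Pi.single u 1 = H ↔ G = H - Pi.single u 1 := by
  have : (Pi.single u 1 : U → ℕ) ≤ H := by
    intro V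
    by_cases hV : V = u
    · subst hV
      simpa using Nat.one_le_iff_ne_zero.2 hu
    · simp [hV]
  exact (eq_tsub_iff_add_eq_of_le this).symm

/-- The number of databases with a given histogram is a multinomial coefficient. -/
theorem card_hist_eq_mul_prod_factorial (n : ℕ) (H : Ranking m → ℕ) (hH : ∑ V, H V = n) :
    (∑ d : Fin n → Ranking m, if hist (List.ofFn d) = H then 1 else 0) *
      ∏ V, (H V).factorial = n.factorial := by
  induction n generalizing H with
  | zero =>
    have h0 : H = 0 := by
      funext V
      simpa using (Finset.sum_eq_zero_iff.1 hH) V (Finset.mem_univ V)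
    subst h0
    have : hist ([] : List (Ranking m)) = 0 := by
      funext V
      simp [hist]
    simp [this]
  | succ n ih =>
    -- Splitting on the first vote `u`: the other votes must have histogram `H` with one `u`
    -- removed. Summing `H u` over `u` then produces the factor `n + 1`.
    have hstep : ∀ u : Ranking m,
        (∑ d : Fin n → Ranking m, if hist (u :: List.ofFn d) = H then 1 else 0) *
          ∏ V, (H V).factorial = H u * n.factorial := by
      intro u
      by_cases hu : H u = 0
      · have : ∀ d : Fin n → Ranking m, hist (u :: List.ofFn d) ≠ H := by
          intro d h
          have := congrFun h u
          rw [hist_cons, hu] at this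
          simp at this
        simp [this, hu]
      · simp only [hist_cons, add_single_eq_iff hu]
        rw [prod_factorial_eq_mul hu, mul_left_comm, ih]
        have h1 : ∑ V, (H - Pi.single u 1 + Pi.single u 1 : Ranking m → ℕ) V = n + 1 := by
          rw [(add_single_eq_iff hu).2 rfl, hH]
        simp only [Pi.add_apply, Finset.sum_add_distrib, Fintype.sum_pi_single'] at h1
        omega
    rw [← (Fin.insertNthEquiv (fun _ => Ranking m) 0).sum_comp, Fintype.sum_prod_type,
      Finset.sum_mul]
    have hcons : ∀ (u : Ranking m) (d : Fin n → Ranking m),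
        hist (List.ofFn (Fin.insertNthEquiv (fun _ => Ranking m) 0 (u, d))) =
          hist (u :: List.ofFn d) := hist_ofFn_insertNth 0
    simp only [hcons]
    rw [Finset.sum_congr rfl fun u _ => hstep u, ← Finset.sum_mul, hH, Nat.factorial_succ]

theorem factorial_le_stirling {n : ℕ} (hn : n ≠ 0) :
    (n.factorial : ℝ) ≤ Real.exp 1 * √n * (n / Real.exp 1) ^ n := by
  obtain ⟨k, rfl⟩ := Nat.exists_eq_succ_of_ne_zero hn
  have h := Stirling.stirlingSeq'_antitone (Nat.zero_le k)
  simp only [Function.comp_apply, Nat.succ_eq_add_one, zero_add, Stirling.stirlingSeq_one] at h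
  rw [Stirling.stirlingSeq, div_le_iff₀ (by positivity)] at h
  refine h.trans (le_of_eq ?_)
  rw [Nat.succ_eq_add_one, Real.sqrt_mul (by norm_num)]
  field_simp

theorem sqrt_mul_pow_le_factorial (n : ℕ) : √n * (n / Real.exp 1) ^ n ≤ (n.factorial : ℝ) := by
  refine le_trans ?_ (Stirling.le_factorial_stirling n)
  gcongr
  nlinarith [Real.pi_gt_three, (Nat.cast_nonneg n : (0 : ℝ) ≤ n)]

/-- With `μ = n / N`, `N` the number of values, the inequality `x ≤ exp (x - 1)` at `x = H V / μ`
bounds the relative entropy by the chi-square sum of `(H V - μ) ^ 2 / μ`. That sum stays bounded for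
deviations of order `√n`. -/
theorem prod_pow_self_le {U : Type*} [Fintype U] {H : U → ℕ} {n : ℕ} (hn : n ≠ 0)
    (hsum : ∑ V, H V = n) {C : ℝ}
    (hC : ∀ V, |(H V : ℝ) - n / Fintype.card U| ≤ C * √n) :
    (∏ V, ((H V : ℝ) / Real.exp 1) ^ H V) * (Fintype.card U : ℝ) ^ n ≤
      (n / Real.exp 1) ^ n * Real.exp ((Fintype.card U : ℝ) ^ 2 * C ^ 2) := by
  have hN : (0 : ℝ) < Fintype.card U := by
    have : Nonempty U := by
      by_contra h
      rw [not_nonempty_iff] at h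
      simp at hsum
      exact hn hsum.symm
    exact_mod_cast Fintype.card_pos
  set N : ℝ := (Fintype.card U : ℝ) with hNdef
  have hn0 : (0 : ℝ) < n := by exact_mod_cast Nat.pos_of_ne_zero hn
  set μ : ℝ := n / N with hμ
  have hμ0 : 0 < μ := by positivity
  have hsum' : ∑ V, (H V : ℝ) = n := by exact_mod_cast hsum
  have hterm : ∀ V, ((H V : ℝ) / Real.exp 1) ^ H V ≤
      (μ / Real.exp 1) ^ H V * Real.exp (H V * (H V / μ - 1)) := by
    intro V
    rw [Real.exp_nat_mul, ← mul_pow]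
    have h1 : (H V : ℝ) / μ ≤ Real.exp (H V / μ - 1) := by
      have := Real.add_one_le_exp ((H V : ℝ) / μ - 1)
      linarith
    rw [div_le_iff₀ hμ0] at h1
    gcongr
    rw [div_mul_eq_mul_div, mul_comm μ]
    gcongr
  have hexp : ∑ V, (H V : ℝ) * (H V / μ - 1) ≤ N ^ 2 * C ^ 2 := by
    have h1 : ∀ V, (H V : ℝ) * (H V / μ - 1) = (H V - μ) ^ 2 / μ + (H V - μ) := by
      intro V
      field_simp
      ring
    have h2 : ∑ V, ((H V : ℝ) - μ) = 0 := by
      rw [Finset.sum_sub_distrib, hsum']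
      simp only [Finset.sum_const, Finset.card_univ, nsmul_eq_mul, ← hNdef, hμ]
      field_simp
      ring
    rw [Finset.sum_congr rfl fun V _ => h1 V, Finset.sum_add_distrib, h2, add_zero]
    have h3 : ∀ V, ((H V : ℝ) - μ) ^ 2 / μ ≤ N * C ^ 2 := by
      intro V
      rw [div_le_iff₀ hμ0]
      have h4 := pow_le_pow_left₀ (abs_nonneg _) (hC V) 2
      rw [sq_abs, mul_pow, Real.sq_sqrt hn0.le] at h4
      refine h4.trans (le_of_eq ?_)
      rw [hμ]
      field_simp
    calc ∑ V, ((H V : ℝ) - μ) ^ 2 / μ ≤ ∑ _V : U, N * C ^ 2 := Finset.sum_le_sum fun V _ => h3 V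
      _ = N ^ 2 * C ^ 2 := by
        simp only [Finset.sum_const, Finset.card_univ, nsmul_eq_mul, ← hNdef]
        ring
  calc (∏ V, ((H V : ℝ) / Real.exp 1) ^ H V) * N ^ n
      ≤ (∏ V, (μ / Real.exp 1) ^ H V * Real.exp (H V * (H V / μ - 1))) * N ^ n := by
        gcongr with V _
        exact hterm V
    _ = (n / Real.exp 1) ^ n * Real.exp (∑ V, (H V : ℝ) * (H V / μ - 1)) := by
        rw [Finset.prod_mul_distrib, Finset.prod_pow_eq_pow_sum, hsum, Real.exp_sum,
          mul_right_comm, ← mul_pow]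
        congr 2
        rw [hμ]
        field_simp
    _ ≤ _ := by gcongr

/-- Stirling bounds each factorial in the product above, with a prefactor at most a multiple of
`√n`, and bounds `n.factorial` below with the prefactor `√n`. The net power of `√n` is one less than
the number of values. -/
theorem prod_factorial_mul_pow_le {U : Type*} [Fintype U] {H : U → ℕ} {n : ℕ}
    (hH : ∀ V, H V ≠ 0) (hn : n ≠ 0) (hsum : ∑ V, H V = n) {C : ℝ}
    (hC : ∀ V, |(H V : ℝ) - n / Fintype.card U| ≤ C * √n) :
    (∏ V, ((H V).factorial : ℝ)) * (Fintype.card U : ℝ) ^ n * √n ≤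
      Real.exp 1 ^ Fintype.card U * Real.exp ((Fintype.card U : ℝ) ^ 2 * C ^ 2) *
        √n ^ Fintype.card U * n.factorial := by
  have h1 : ∏ V, ((H V).factorial : ℝ) ≤
      ∏ V, (Real.exp 1 * √n * ((H V : ℝ) / Real.exp 1) ^ H V) := by
    refine Finset.prod_le_prod (fun V _ => by positivity) fun V _ => ?_
    refine (factorial_le_stirling (hH V)).trans ?_
    gcongr
    rw [← hsum]
    exact Finset.single_le_sum (fun V _ => Nat.zero_le _) (Finset.mem_univ V)
  rw [Finset.prod_mul_distrib, Finset.prod_const, Finset.card_univ, mul_pow] at h1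
  calc (∏ V, ((H V).factorial : ℝ)) * (Fintype.card U : ℝ) ^ n * √n
      ≤ (Real.exp 1 ^ Fintype.card U * √n ^ Fintype.card U *
          ∏ V, ((H V : ℝ) / Real.exp 1) ^ H V) * (Fintype.card U : ℝ) ^ n * √n := by gcongr
    _ = (Real.exp 1 ^ Fintype.card U * √n ^ Fintype.card U * √n) *
          ((∏ V, ((H V : ℝ) / Real.exp 1) ^ H V) * (Fintype.card U : ℝ) ^ n) := by ring
    _ ≤ (Real.exp 1 ^ Fintype.card U * √n ^ Fintype.card U * √n) *
          ((n / Real.exp 1) ^ n * Real.exp ((Fintype.card U : ℝ) ^ 2 * C ^ 2)) := by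
        exact mul_le_mul_of_nonneg_left (prod_pow_self_le hn hsum hC) (by positivity)
    _ = (Real.exp 1 ^ Fintype.card U * Real.exp ((Fintype.card U : ℝ) ^ 2 * C ^ 2) *
          √n ^ Fintype.card U) * (√n * (n / Real.exp 1) ^ n) := by ring
    _ ≤ _ := by
        gcongr
        exact sqrt_mul_pow_le_factorial n

theorem expect_uniform {U : Type*} [Fintype U] [Nonempty U] (n : ℕ) (f : (Fin n → U) → ℝ) :
    expect (fun u => (PMF.uniformOfFintype U u).toReal) n f =
      (∑ d, f d) / (Fintype.card U : ℝ) ^ n := by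
  simp [expect, ← Finset.mul_sum, div_eq_inv_mul]

/-- Every profile within `O(√n)` of the uniform one has probability of the order of the local
limit theorem. -/
theorem le_expect_hist_eq {H : Ranking m → ℕ} {n : ℕ} (hH : ∀ V, H V ≠ 0) (hn : n ≠ 0)
    (hsum : ∑ V, H V = n) {C : ℝ}
    (hC : ∀ V, |(H V : ℝ) - n / Fintype.card (Ranking m)| ≤ C * √n) :
    √n / (Real.exp 1 ^ Fintype.card (Ranking m) *
      Real.exp ((Fintype.card (Ranking m) : ℝ) ^ 2 * C ^ 2) * √n ^ Fintype.card (Ranking m)) ≤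
    expect (fun V => (PMF.uniformOfFintype (Ranking m) V).toReal) n fun d =>
      if hist (List.ofFn d) = H then 1 else 0 := by
  have h1 := prod_factorial_mul_pow_le hH hn hsum hC
  have hn0 : (0 : ℝ) < n := by exact_mod_cast Nat.pos_of_ne_zero hn
  have hN : (0 : ℝ) < Fintype.card (Ranking m) := by exact_mod_cast Fintype.card_pos
  have hP : 0 < ∏ V, ((H V).factorial : ℝ) := Finset.prod_pos fun V _ => by positivity
  have h2 : (∑ d : Fin n → Ranking m, if hist (List.ofFn d) = H then (1 : ℝ) else 0) *
      ∏ V, ((H V).factorial : ℝ) = n.factorial := by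
    exact_mod_cast card_hist_eq_mul_prod_factorial n H hsum
  rw [expect_uniform, div_le_div_iff₀ (by positivity) (by positivity)]
  refine le_of_mul_le_mul_right ?_ hP
  calc _ = (∏ V, ((H V).factorial : ℝ)) * (Fintype.card (Ranking m) : ℝ) ^ n * √n := by ring
    _ ≤ _ := h1
    _ = _ := by
      rw [← h2]
      ring

end Multinomial

/-! ### Profiles at which one vote is decisive -/

section Decisive

variable {m : ℕ}

theorem rule_add_const {r : GSR m} (hcancel : CancelingOut r.rule) (P : Ranking m → ℕ) (k : ℕ) :
    r.rule (fun V => P V + k) = r.rule P := by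
  induction k with
  | zero => rfl
  | succ k ih => rw [← ih, hcancel fun V => P V + k]; rfl

theorem winner_div (r : GSR m) (p : Ranking m → ℝ) {s : ℝ} (hs : 0 < s) :
    r.winner (fun V => p V / s) = r.winner p := by
  refine congrArg r.g (funext fun j => ?_)
  have : ∑ V, r.h j V * (p V / s) = (∑ V, r.h j V * p V) * s⁻¹ := by
    rw [Finset.sum_mul]
    exact Finset.sum_congr rfl fun V _ => by ring
  rw [this, sign_mul, sign_pos (inv_pos.2 hs), mul_one]

theorem rule_eq_winner_div (r : GSR m) (Q : Ranking m → ℕ) {s : ℝ} (hs : 0 < s) :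
    r.rule Q = r.winner fun V => (Q V : ℝ) / s :=
  (winner_div r _ hs).symm

/-- The profile `Q` with `j` of the `W` votes turned into `V` votes. -/
def moveVotes (Q : Ranking m → ℕ) (W V : Ranking m) (j : ℕ) : Ranking m → ℕ :=
  Q - Pi.single W j + Pi.single V j

/-- By homogeneity the winner at `Q` is the winner at `Q / s`, a point of the stable ball. So `a`
loses before any vote is moved and wins after all of them are, and the first move after which `a`
wins is the switch. -/
theorem exists_switch {r : GSR m} {P : Ranking m → ℕ} {γ : ℝ} {a : Fin m} {W V : Ranking m}
    (hWV : W ≠ V)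
    (hstable : ∀ p : Ranking m → ℝ, (∀ U, |p U - (P U : ℝ)| ≤ γ) →
      r.winner p ≠ a ∧ r.winner (replaceAll p W V) = a)
    {s : ℕ} (hs : 0 < s) {Q : Ranking m → ℕ} (hQ : ∀ U, |(Q U : ℝ) - s * P U| ≤ γ * s) :
    ∃ j < Q W, r.rule (moveVotes Q W V j) ≠ a ∧ r.rule (moveVotes Q W V (j + 1)) = a := by
  classical
  have hs' : (0 : ℝ) < s := by exact_mod_cast hs
  obtain ⟨h0, h1⟩ := hstable (fun U => (Q U : ℝ) / s) fun U => by
    rw [div_sub' hs'.ne', abs_div, abs_of_pos hs', div_le_iff₀ hs']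
    exact hQ U
  have hstart : r.rule (moveVotes Q W V 0) ≠ a := by
    have : moveVotes Q W V 0 = Q := by simp [moveVotes]
    rwa [this, rule_eq_winner_div r Q hs']
  have hend : r.rule (moveVotes Q W V (Q W)) = a := by
    rw [← h1, rule_eq_winner_div r _ hs']
    congr 1
    funext U
    simp only [moveVotes, replaceAll, Pi.add_apply, Pi.sub_apply, Pi.single_apply]
    by_cases hW : U = W
    · subst hW
      simp [hWV]
    · by_cases hV : U = V
      · subst hV
        simp [hW, add_div]
      · simp [hW, hV]
  have hex : ∃ j, r.rule (moveVotes Q W V j) = a := ⟨_, hend⟩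
  have hpos : Nat.find hex ≠ 0 := fun h => hstart (h ▸ Nat.find_spec hex)
  obtain ⟨j, hj⟩ := Nat.exists_eq_succ_of_ne_zero hpos
  refine ⟨j, ?_, Nat.find_min hex (by omega), ?_⟩
  · have := Nat.find_min' hex hend
    omega
  · have := Nat.find_spec hex
    rwa [hj] at this

/-- Every integer profile near the ray of a locally stable profile gives a profile at which the
choice between one more vote `W` and one more vote `V` is decisive. -/
theorem exists_decisive {r : GSR m} (hcancel : CancelingOut r.rule) {P : Ranking m → ℕ} {γ : ℝ}
    {a : Fin m} {W V : Ranking m} (hWV : W ≠ V)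
    (hstable : ∀ p : Ranking m → ℝ, (∀ U, |p U - (P U : ℝ)| ≤ γ) →
      r.winner p ≠ a ∧ r.winner (replaceAll p W V) = a)
    {s : ℕ} (hs : 0 < s) {Q : Ranking m → ℕ} (hQ : ∀ U, |(Q U : ℝ) - s * P U| ≤ γ * s) (k : ℕ) :
    ∃ H : Ranking m → ℕ, (∀ U, U ≠ W → U ≠ V → H U = k + Q U) ∧
      (∀ U, k ≤ H U ∧ H U ≤ k + ∑ U, Q U) ∧
      (∑ U, H U) + 1 = (∑ U, Q U) + Fintype.card (Ranking m) * k ∧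
      r.rule (H + Pi.single W 1) ≠ a ∧ r.rule (H + Pi.single V 1) = a := by
  obtain ⟨j, hj, h0, h1⟩ := exists_switch hWV hstable hs hQ
  have hle : ∀ U, Q U ≤ ∑ U, Q U := fun U =>
    Finset.single_le_sum (fun U _ => Nat.zero_le _) (Finset.mem_univ U)
  have hle2 : Q W + Q V ≤ ∑ U, Q U := by
    rw [← Finset.sum_pair hWV]
    exact Finset.sum_le_sum_of_subset (Finset.subset_univ _)
  -- The profile common to both sides of the switch: the vote being moved is left out, so adding it
  -- as `W` or as `V` gives `j` or `j + 1` moves. The shift by `k` copies of every ranking is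
  -- invisible to the rule.
  set H : Ranking m → ℕ := fun U =>
    k + if U = W then Q W - (j + 1) else if U = V then Q V + j else Q U with hH
  have hHW : H + Pi.single W 1 = fun U => moveVotes Q W V j U + k := by
    funext U
    simp only [hH, moveVotes, Pi.add_apply, Pi.sub_apply, Pi.single_apply]
    by_cases hW : U = W
    · subst hW
      simp only [if_true, if_neg hWV]
      omega
    · by_cases hV : U = V
      · subst hV
        simp only [if_true, if_neg hW]
        omega
      · simp only [if_neg hV, if_neg hW]
        omega
  have hHV : H + Pi.single V 1 = fun U => moveVotes Q W V (j + 1) U + k := by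
    funext U
    simp only [hH, moveVotes, Pi.add_apply, Pi.sub_apply, Pi.single_apply]
    by_cases hW : U = W
    · subst hW
      simp only [if_true, if_neg hWV]
      omega
    · by_cases hV : U = V
      · subst hV
        simp only [if_true, if_neg hW]
        omega
      · simp only [if_neg hV, if_neg hW]
        omega
  refine ⟨H, fun U hW hV => by simp [hH, hW, hV], fun U => ⟨Nat.le_add_right _ _, ?_⟩, ?_, ?_, ?_⟩
  · have := hle U
    simp only [hH]
    split_ifs <;> omega
  · have hpt : ∀ U, H U + (Pi.single W (j + 1) : Ranking m → ℕ) U =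
        k + Q U + (Pi.single V j : Ranking m → ℕ) U := by
      intro U
      simp only [hH, Pi.single_apply]
      by_cases hW : U = W
      · subst hW
        simp only [if_true, if_neg hWV]
        omega
      · by_cases hV : U = V
        · subst hV
          simp only [if_true, if_neg hW]
          omega
        · simp only [if_neg hV, if_neg hW]
    have hsum := Finset.sum_congr (rfl : (Finset.univ : Finset (Ranking m)) = Finset.univ)
      fun U _ => hpt U
    simp only [Finset.sum_add_distrib, Fintype.sum_pi_single', Finset.sum_const, Finset.card_univ,
      smul_eq_mul] at hsum
    omega
  · rw [hHW, rule_add_const hcancel]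
    exact h0
  · rw [hHV, rule_add_const hcancel]
    exact h1

/-- The index set of a family of decisive profiles: offsets below `b` at the rankings other than
`W` and `V`. -/
def offsetBox (W V : Ranking m) (b : ℕ) : Finset (Ranking m → ℕ) :=
  Fintype.piFinset fun U => if U = W ∨ U = V then {0} else Finset.range b

theorem card_offsetBox {W V : Ranking m} (hWV : W ≠ V) (b : ℕ) :
    (offsetBox W V b).card = b ^ (Fintype.card (Ranking m) - 2) := by
  rw [offsetBox, Fintype.card_piFinset]
  have : ∀ U : Ranking m, (if U = W ∨ U = V then ({0} : Finset ℕ) else Finset.range b).card =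
      if U ∈ ({W, V} : Finset (Ranking m)) then 1 else b := by
    intro U
    simp only [Finset.mem_insert, Finset.mem_singleton]
    split_ifs <;> simp
  rw [Finset.prod_congr rfl fun U _ => this U, Finset.prod_ite]
  simp only [Finset.prod_const_one, one_mul, Finset.prod_const]
  congr 1
  rw [← Finset.card_pair hWV, ← Finset.card_univ,
    ← Finset.card_sdiff_of_subset (Finset.subset_univ _)]
  congr 1
  ext U
  simp

/-- Coordinates other than those of `W` and `V` are untouched by the switch, so they recover the
offset `q` and make the family injective. Each entry and the average `n / N` lie between `k` and `k`
plus the size of `Q`, which gives the distance bound. -/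
theorem exists_decisive_family {r : GSR m} (hcancel : CancelingOut r.rule) {P : Ranking m → ℕ}
    {γ : ℝ} {a : Fin m} {W V : Ranking m} (hWV : W ≠ V)
    (hstable : ∀ p : Ranking m → ℝ, (∀ U, |p U - (P U : ℝ)| ≤ γ) →
      r.winner p ≠ a ∧ r.winner (replaceAll p W V) = a)
    {s b n : ℕ} (hs : 0 < s) (hb : (Fintype.card (Ranking m) : ℝ) * (b + 1) ≤ γ * s)
    (hn : s * ((∑ U, P U : ℕ) + γ) + Fintype.card (Ranking m) ≤ n) :
    ∃ F : (Ranking m → ℕ) → Ranking m → ℕ, Set.InjOn F (offsetBox W V b) ∧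
      ∀ q ∈ offsetBox W V b, ∑ U, F q U = n ∧ (∀ U, F q U ≠ 0) ∧
        (∀ U, |(F q U : ℝ) - n / Fintype.card (Ranking m)| ≤ s * ((∑ U, P U : ℕ) + γ)) ∧
        r.rule (F q + Pi.single W 1) ≠ a ∧ r.rule (F q + Pi.single V 1) = a := by
  classical
  set N := Fintype.card (Ranking m) with hN
  have hN0 : 0 < N := Fintype.card_pos
  have hN1 : (1 : ℝ) ≤ N := by exact_mod_cast hN0
  set T := ∑ U, P U with hT
  have hbase : s * T + N * b + N ≤ n := by
    have : ((s * T + N * b + N : ℕ) : ℝ) ≤ n := by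
      push_cast
      nlinarith
    exact_mod_cast this
  -- Division with remainder by `N` fixes the size. It starts from `n + 1` because a decisive
  -- profile lacks the vote being moved.
  obtain ⟨k, ρ, hρ, hk⟩ : ∃ k ρ, ρ < N ∧ n + 1 = s * T + N * b + ρ + N * k :=
    ⟨(n + 1 - (s * T + N * b)) / N, (n + 1 - (s * T + N * b)) % N, Nat.mod_lt _ hN0, by
      have := Nat.mod_add_div (n + 1 - (s * T + N * b)) N
      omega⟩
  have hk0 : 0 < k := by
    by_contra h
    obtain rfl : k = 0 := by omega
    omega
  -- The coordinate of `V` absorbs whatever the offsets leave, so the size of `Q q` does not depend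
  -- on `q`.
  set Q : (Ranking m → ℕ) → Ranking m → ℕ := fun q U =>
    s * P U + if U = V then N * b + ρ - ∑ U, q U else q U with hQ
  have hbox : ∀ q ∈ offsetBox W V b, q V = 0 ∧ q W = 0 ∧ (∀ U, q U ≤ b) ∧ ∑ U, q U ≤ N * b := by
    intro q hq
    have hq' := Fintype.mem_piFinset.1 hq
    have hle : ∀ U, q U ≤ b := by
      intro U
      have := hq' U
      split_ifs at this
      · simp at this
        omega
      · exact (Finset.mem_range.1 this).le
    refine ⟨by simpa using hq' V, by simpa using hq' W, hle, ?_⟩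
    calc ∑ U, q U ≤ ∑ _U : Ranking m, b := Finset.sum_le_sum fun U _ => hle U
      _ = N * b := by simp [hN]
  have hQsum : ∀ q ∈ offsetBox W V b, ∑ U, Q q U = s * T + N * b + ρ := by
    intro q hq
    obtain ⟨hqV, -, -, hle⟩ := hbox q hq
    have hpt : ∀ U, Q q U =
        s * P U + (q U + if U = V then N * b + ρ - ∑ U, q U else 0) := by
      intro U
      simp only [hQ]
      split_ifs with h
      · rw [h, hqV, zero_add]
      · rfl
    simp only [hpt, Finset.sum_add_distrib, ← Finset.mul_sum, Finset.sum_ite_eq', Finset.mem_univ,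
      if_true, ← hT]
    omega
  have hQnear : ∀ q ∈ offsetBox W V b, ∀ U, |(Q q U : ℝ) - s * P U| ≤ γ * s := by
    intro q hq U
    obtain ⟨-, -, hqb, -⟩ := hbox q hq
    have h1 : (if U = V then N * b + ρ - ∑ U, q U else q U) ≤ N * (b + 1) := by
      split_ifs
      · rw [mul_add]
        omega
      · exact (hqb U).trans ((Nat.le_succ b).trans (Nat.le_mul_of_pos_left _ hN0))
    have h2 : (((if U = V then N * b + ρ - ∑ U, q U else q U : ℕ)) : ℝ) ≤ N * (b + 1) := by
      exact_mod_cast h1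
    rw [show (Q q U : ℝ) - s * P U = ((if U = V then N * b + ρ - ∑ U, q U else q U : ℕ) : ℝ) by
      simp only [hQ]
      rw [Nat.cast_add, Nat.cast_mul, add_sub_cancel_left], abs_of_nonneg (Nat.cast_nonneg _)]
    exact h2.trans hb
  have hex : ∀ q, ∃ H : Ranking m → ℕ, q ∈ offsetBox W V b →
      (∀ U, U ≠ W → U ≠ V → H U = k + Q q U) ∧ (∀ U, k ≤ H U ∧ H U ≤ k + ∑ U, Q q U) ∧
      (∑ U, H U) + 1 = (∑ U, Q q U) + N * k ∧
      r.rule (H + Pi.single W 1) ≠ a ∧ r.rule (H + Pi.single V 1) = a := by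
    intro q
    by_cases hq : q ∈ offsetBox W V b
    · obtain ⟨H, hH⟩ := exists_decisive hcancel hWV hstable hs (hQnear q hq) k
      exact ⟨H, fun _ => hH⟩
    · exact ⟨0, fun h => absurd h hq⟩
  choose F hF using hex
  refine ⟨F, ?_, fun q hq => ?_⟩
  · intro q hq q' hq' heq
    have hq := Finset.mem_coe.1 hq
    have hq' := Finset.mem_coe.1 hq'
    funext U
    by_cases hW : U = W
    · rw [hW, (hbox q hq).2.1, (hbox q' hq').2.1]
    · by_cases hV : U = V
      · rw [hV, (hbox q hq).1, (hbox q' hq').1]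
      · have h1 := (hF q hq).1 U hW hV
        have h2 := (hF q' hq').1 U hW hV
        rw [heq, h2] at h1
        simp only [hQ, if_neg hV] at h1
        omega
  · obtain ⟨-, hbd, hsum, hW, hV⟩ := hF q hq
    have hsumn : ∑ U, F q U = n := by
      rw [hQsum q hq] at hsum
      omega
    refine ⟨hsumn, fun U => ?_, fun U => ?_, hW, hV⟩
    · have := (hbd U).1
      omega
    · rw [hQsum q hq] at hbd
      have hK : ((s * T + N * b + ρ : ℕ) : ℝ) ≤ s * ((T : ℝ) + γ) := by
        have : (ρ : ℝ) ≤ N := by exact_mod_cast hρ.le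
        push_cast
        nlinarith
      have hlow : (k : ℝ) ≤ n / N := by
        rw [le_div_iff₀ (by positivity)]
        have : N * k ≤ n := by
          rw [← hsumn]
          calc N * k = ∑ _U : Ranking m, k := by simp [hN]
            _ ≤ _ := Finset.sum_le_sum fun U _ => (hbd U).1
        rw [mul_comm]
        exact_mod_cast this
      have hupp : (n : ℝ) / N ≤ k + (s * T + N * b + ρ : ℕ) := by
        rw [div_le_iff₀ (by positivity)]
        have : n ≤ N * (k + (s * T + N * b + ρ)) := by
          rw [← hsumn]
          calc _ ≤ ∑ _U : Ranking m, (k + (s * T + N * b + ρ)) :=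
                Finset.sum_le_sum fun U _ => (hbd U).2
            _ = _ := by simp [hN]
        rw [mul_comm]
        exact_mod_cast this
      have h1 : (k : ℝ) ≤ F q U := by exact_mod_cast (hbd U).1
      have h2 : (F q U : ℝ) ≤ k + (s * T + N * b + ρ : ℕ) := by exact_mod_cast (hbd U).2
      rw [abs_le]
      constructor <;> linarith

theorem replaceOne_add_single (G : Ranking m → ℕ) (W V : Ranking m) :
    replaceOne (G + Pi.single W 1) W V = G + Pi.single V 1 := by
  rw [replaceOne, add_tsub_cancel_right]

/-- The winning probability of `a` increases with the vote by at least the probability of any set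
of profiles at which the vote is decisive. -/
theorem sum_expect_le_prob_sub {r : GSR m} (hmono : MonotoneRule r.rule) {a : Fin m}
    {W V : Ranking m} (hraise : Raises a W V) (π : PMF (Ranking m)) {n : ℕ} {ι : Type*}
    {s : Finset ι} {F : ι → Ranking m → ℕ} (hinj : Set.InjOn F s)
    (hF : ∀ q ∈ s, r.rule (F q + Pi.single W 1) ≠ a ∧ r.rule (F q + Pi.single V 1) = a) :
    ∑ q ∈ s, (expect (fun V => (π V).toReal) n fun d =>
      if hist (List.ofFn d) = F q then 1 else 0) ≤
    prob (rowOutput r.mechanism π n V) {a} - prob (rowOutput r.mechanism π n W) {a} := by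
  classical
  rw [prob_rowOutput, prob_rowOutput, ← expect_sub, ← expect_sum]
  refine expect_mono (fun V => ENNReal.toReal_nonneg) n fun d => ?_
  set G := hist (List.ofFn d)
  rw [hist_cons, hist_cons, ← Finset.sum_filter, Finset.sum_const, nsmul_eq_mul, mul_one]
  have hcard : (s.filter fun q => G = F q).card ≤ 1 := by
    rw [Finset.card_le_one]
    intro q hq q' hq'
    rw [Finset.mem_filter] at hq hq'
    exact hinj hq.1 hq'.1 (hq.2.symm.trans hq'.2)
  -- Monotonicity makes the difference of the two indicators nonnegative at every profile, so
  -- profiles outside the family cannot cancel its contribution.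
  have hm' : r.rule (G + Pi.single W 1) = a → r.rule (G + Pi.single V 1) = a := by
    intro h
    have := hmono (G + Pi.single W 1) W V (by simp) (h.symm ▸ hraise)
    rwa [replaceOne_add_single, h] at this
  rcases (s.filter fun q => G = F q).eq_empty_or_nonempty with he | ⟨q, hq⟩
  · rw [he, Finset.card_empty, Nat.cast_zero, sub_nonneg]
    by_cases h : r.rule (G + Pi.single W 1) = a
    · rw [h, hm' h]
    · rw [Set.indicator_of_notMem (show _ ∉ ({a} : Set (Fin m)) from h)]
      exact Set.indicator_nonneg (fun _ _ => zero_le_one) _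
  · rw [Finset.mem_filter] at hq
    obtain ⟨h1, h2⟩ := hF q hq.1
    rw [← hq.2] at h1 h2
    rw [Set.indicator_of_notMem (show _ ∉ ({a} : Set (Fin m)) from h1), h2,
      Set.indicator_of_mem (Set.mem_singleton a), Pi.one_apply, sub_zero]
    exact_mod_cast hcard

end Decisive

/-! ### Matching lower bound for uniform votes, and assembly of the exact parameters. -/

section Main

variable {m : ℕ}

theorem two_le_card_ranking (hm : 2 ≤ m) : 2 ≤ Fintype.card (Ranking m) := by
  rw [Fintype.card_perm, Fintype.card_fin]
  exact hm.trans (Nat.self_le_factorial m)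

theorem exists_div_sqrt_le_pairwiseOptimum (hm : 2 ≤ m) {r : GSR m}
    (hcancel : CancelingOut r.rule) (hmono : MonotoneRule r.rule)
    (hstable : ∃ P : Ranking m → ℕ, LocallyStable r P) :
    ∃ c : ℝ, 0 < c ∧ ∀ᶠ n : ℕ in Filter.atTop, c / √n ≤
      pairwiseOptimum (rowOutput r.mechanism (PMF.uniformOfFintype (Ranking m)) n) := by
  obtain ⟨P, γ, a, W, V, hγ, hraise, hst⟩ := hstable
  have hWV : W ≠ V := by
    rintro rfl
    exact lt_irrefl _ hraise.1
  set N := Fintype.card (Ranking m) with hN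
  have hN2 : 2 ≤ N := two_le_card_ranking hm
  have hN0 : (0 : ℝ) < N := by positivity
  set K : ℝ := (∑ U, P U : ℕ) + γ with hK
  have hK0 : 0 < K := by positivity
  set A : ℝ := Real.exp 1 ^ N * Real.exp ((N : ℝ) ^ 2 * K ^ 2) with hA
  have hA0 : 0 < A := by positivity
  set c₁ : ℝ := γ / (4 * N) with hc₁
  have hc₁0 : 0 < c₁ := by positivity
  refine ⟨c₁ ^ (N - 2) / A, by positivity, ?_⟩
  obtain ⟨s₀, hs₀⟩ := exists_nat_ge (max (4 * N / γ) (K + N))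
  filter_upwards [Filter.eventually_ge_atTop (s₀ ^ 2 + 1)] with n hn
  -- The scale is `√n`: small enough for the decisive profiles to stay within `K * √n` of uniform,
  -- large enough for the box of offsets to have side of order `√n`.
  set s := Nat.sqrt n with hs
  have hss₀ : s₀ ≤ s := by
    rw [hs, Nat.le_sqrt']
    omega
  have hs1 : 1 ≤ s := by
    rw [hs, Nat.le_sqrt']
    omega
  have hs1' : (1 : ℝ) ≤ s := by exact_mod_cast hs1
  have hbig : max (4 * N / γ) (K + N) ≤ (s : ℝ) := hs₀.trans (by exact_mod_cast hss₀)
  have hbig1 : 4 * N ≤ s * γ := (div_le_iff₀ hγ).1 ((le_max_left _ _).trans hbig)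
  have hbig2 : K + N ≤ s := (le_max_right _ _).trans hbig
  have hsn : (s : ℝ) ≤ √n := Real.nat_sqrt_le_real_sqrt
  have hns : √n ≤ 2 * s := (Real.real_sqrt_le_nat_sqrt_succ).trans (by linarith)
  have hn0 : n ≠ 0 := by omega
  have hsq : (s : ℝ) ^ 2 ≤ n := by exact_mod_cast Nat.sqrt_le' n
  have hrt0 : 0 < √(n : ℝ) := (one_pos.trans_le hs1').trans_le hsn
  -- Essentially the largest side for which the offsets, and the remainder collected at `V`, keep
  -- `Q` in the ball of radius `γ * s`.
  set b := ⌊γ * s / N⌋₊ - 1 with hb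
  have hfl : γ * s / N - 1 < ⌊γ * s / N⌋₊ := Nat.sub_one_lt_floor _
  have hfl' : (⌊γ * s / N⌋₊ : ℝ) ≤ γ * s / N := Nat.floor_le (by positivity)
  have hge4 : 4 ≤ γ * s / N := by
    rw [le_div_iff₀ hN0]
    linarith
  have hfl1 : 1 ≤ ⌊γ * s / N⌋₊ := by
    have : (0 : ℝ) < ⌊γ * s / N⌋₊ := by linarith
    exact_mod_cast this
  have hbcast : (b : ℝ) = ⌊γ * s / N⌋₊ - 1 := by
    rw [hb, Nat.cast_sub hfl1, Nat.cast_one]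
  have hbN : (N : ℝ) * (b + 1) ≤ γ * s := by
    rw [hbcast, sub_add_cancel, mul_comm]
    exact (le_div_iff₀ hN0).1 hfl'
  have hbge : c₁ * √n ≤ b := by
    calc c₁ * √n ≤ c₁ * (2 * s) := by gcongr
      _ = γ * s / N / 2 := by
        rw [hc₁]
        field_simp
        ring
      _ ≤ b := by linarith
  have hnK : s * K + N ≤ n := by nlinarith
  obtain ⟨F, hinj, hF⟩ := exists_decisive_family hcancel hWV hst hs1 hbN hnK
  have hlow := sum_expect_le_prob_sub hmono hraise (PMF.uniformOfFintype (Ranking m)) (n := n) hinj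
    fun q hq => (hF q hq).2.2.2
  have hopt : prob (rowOutput r.mechanism (PMF.uniformOfFintype (Ranking m)) n V) {a} -
      prob (rowOutput r.mechanism (PMF.uniformOfFintype (Ranking m)) n W) {a} ≤
      pairwiseOptimum (rowOutput r.mechanism (PMF.uniformOfFintype (Ranking m)) n) := by
    have := (pairwiseOptimum_le_iff (rowOutput r.mechanism
      (PMF.uniformOfFintype (Ranking m)) n) _).1 le_rfl V W {a}
    rw [toOuterMeasure_le_add_iff] at this
    linarith
  refine le_trans ?_ (hlow.trans hopt)
  -- Number of decisive profiles times the least probability of one: the powers of `√n` are `N - 2`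
  -- and `1 - N`, leaving a single `√n` in the denominator.
  calc c₁ ^ (N - 2) / A / √n = (c₁ * √n) ^ (N - 2) * (√n / (A * √n ^ N)) := by
        obtain ⟨M, hM⟩ := Nat.exists_eq_add_of_le' hN2
        rw [hM, Nat.add_sub_cancel, mul_pow, pow_add]
        field_simp
    _ ≤ (b : ℝ) ^ (N - 2) * (√n / (A * √n ^ N)) := by gcongr
    _ = ∑ _q ∈ offsetBox W V b, √n / (A * √n ^ N) := by
        rw [Finset.sum_const, card_offsetBox hWV, nsmul_eq_mul]
        push_cast
        rfl
    _ ≤ _ := by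
        refine Finset.sum_le_sum fun q hq => ?_
        obtain ⟨hsum, hpos, hnear, -⟩ := hF q hq
        refine le_expect_hist_eq hpos hn0 hsum fun U => (hnear U).trans ?_
        rw [mul_comm]
        gcongr

/-- The index is `n - 1` because `rowOutput` adds the conditioned row to its i.i.d. votes, so that
`n` counts all rows. -/
theorem pairwiseOptimum_pred_isBigO_sqrt (r : GSR m) {π : PMF (Ranking m)} (hπ : ∀ V, 0 < π V) :
    (fun n : ℕ => (pairwiseOptimum (rowOutput r.mechanism π (n - 1)) : ℝ)) =O[Filter.atTop]
      fun n : ℕ => 1 / √(n : ℝ) := by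
  obtain ⟨C, hC⟩ := exists_pairwiseOptimum_le_div_sqrt r hπ
  refine Asymptotics.IsBigO.of_bound C ?_
  filter_upwards [Filter.eventually_ge_atTop 1] with n hn
  have h := hC (n - 1)
  rw [Nat.cast_sub hn, Nat.cast_one, sub_add_cancel] at h
  rw [Real.norm_of_nonneg (NNReal.coe_nonneg _), Real.norm_of_nonneg (by positivity),
    mul_one_div]
  exact h

theorem pairwiseOptimum_pred_isTheta (hm : 2 ≤ m) {r : GSR m} (hcancel : CancelingOut r.rule)
    (hmono : MonotoneRule r.rule) (hstable : ∃ P : Ranking m → ℕ, LocallyStable r P) :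
    (fun n : ℕ => (pairwiseOptimum
      (rowOutput r.mechanism (PMF.uniformOfFintype (Ranking m)) (n - 1)) : ℝ)) =Θ[Filter.atTop]
        fun n : ℕ => 1 / √(n : ℝ) := by
  refine ⟨pairwiseOptimum_pred_isBigO_sqrt r fun V => by simp, ?_⟩
  obtain ⟨c, hc0, hc⟩ := exists_div_sqrt_le_pairwiseOptimum hm hcancel hmono hstable
  refine Asymptotics.IsBigO.of_bound c⁻¹ ?_
  filter_upwards [(Filter.tendsto_sub_atTop_nat 1).eventually hc,
    Filter.eventually_ge_atTop 2] with n hn hn2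
  rw [Real.norm_of_nonneg (NNReal.coe_nonneg _), Real.norm_of_nonneg (by positivity)]
  rw [inv_mul_eq_div, le_div_iff₀ hc0, mul_comm, mul_one_div]
  refine le_trans ?_ hn
  have : 0 < n - 1 := by omega
  gcongr
  exact Nat.sub_le n 1

theorem isDDP_of_pairwiseOptimum_le (r : GSR m) {π : PMF (Ranking m)} (hπ : ∀ V, 0 < π V) {n : ℕ}
    {δ : ℝ≥0} (h : pairwiseOptimum (rowOutput r.mechanism π n) ≤ δ) :
    IsDDP r.mechanism {noAux (iidDatabase π (n + 1))} 0 δ :=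
  (isDDP_iidDatabase_iff (mechanism_perm r) hπ n δ).2 (exists_simulator_of_pairwiseOptimum_le h)

theorem isPairwiseDDP_iff_pairwiseOptimum_le (r : GSR m) {π : PMF (Ranking m)}
    (hπ : ∀ V, 0 < π V) (n : ℕ) (δ : ℝ≥0) :
    IsPairwiseDDP r.mechanism {iidDatabase π (n + 1)} 0 δ ↔
      pairwiseOptimum (rowOutput r.mechanism π n) ≤ δ := by
  rw [isPairwiseDDP_iidDatabase_iff (mechanism_perm r) hπ, pairwiseOptimum_le_iff]

/-- The exact simulation-based parameter lies between half the pairwise one and the pairwise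
one. -/
theorem exists_isExact_isDDP (r : GSR m) {π : PMF (Ranking m)} (hπ : ∀ V, 0 < π V) (n : ℕ) :
    ∃ δ : ℝ≥0, IsExact (IsDDP r.mechanism {noAux (iidDatabase π (n + 1))}) 0 δ ∧
      δ ≤ pairwiseOptimum (rowOutput r.mechanism π n) ∧
      pairwiseOptimum (rowOutput r.mechanism π n) ≤ 2 * δ := by
  have : Nonempty (Fin m) := ⟨(r.mechanism []).support_nonempty.some⟩
  obtain ⟨δ, hδ⟩ := exists_simulator_optimum (rowOutput r.mechanism π n)
  exact ⟨δ, isExact_zero fun δ' => by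
    rw [isDDP_iidDatabase_iff (mechanism_perm r) hπ, hδ],
    (hδ _).2 (exists_simulator_of_pairwiseOptimum_le le_rfl),
    pairwiseOptimum_le_two_mul ((hδ δ).1 le_rfl)⟩

end Main

end

end VotingDDP

theorem mainTheorem1 (m : ℕ) (hm : 2 ≤ m) (r : GSR m)
    (hcancel : CancelingOut r.rule) (hmono : MonotoneRule r.rule)
    (hstable : ∃ P : Ranking m → ℕ, LocallyStable r P) :
    ((∃ δ : ℕ → ℝ≥0,
        (∀ n : ℕ, 1 ≤ n → IsExact
          (IsDDP r.mechanism
            {noAux (iidDatabase (PMF.uniformOfFintype (Ranking m)) n)}) 0 (δ n)) ∧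
        (fun n : ℕ => (δ n : ℝ)) =Θ[Filter.atTop] fun n : ℕ => 1 / √(n : ℝ)) ∧
      (∃ δ : ℕ → ℝ≥0,
        (∀ n : ℕ, 1 ≤ n → IsExact
          (IsPairwiseDDP r.mechanism
            {iidDatabase (PMF.uniformOfFintype (Ranking m)) n}) 0 (δ n)) ∧
        (fun n : ℕ => (δ n : ℝ)) =Θ[Filter.atTop] fun n : ℕ => 1 / √(n : ℝ))) ∧
    ∀ π : PMF (Ranking m), (∀ V, 0 < π V) →
      ∃ δ : ℕ → ℝ≥0,
        (∀ n : ℕ, 1 ≤ n →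
          IsDDP r.mechanism {noAux (iidDatabase π n)} 0 (δ n) ∧
          IsPairwiseDDP r.mechanism {iidDatabase π n} 0 (δ n)) ∧
        (fun n : ℕ => (δ n : ℝ)) =O[Filter.atTop] fun n : ℕ =>
          min
            (Real.exp (-((⨅ j, hyperplaneDist (fun V => (π V).toReal) (r.h j)) ^ 2 /
              (3 * (m.factorial : ℝ) * ⨆ V, (π V).toReal)) * n))
            √(1 / (n : ℝ)) := by
  have hunif : ∀ V, 0 < PMF.uniformOfFintype (Ranking m) V := fun V => by simp
  have htheta := pairwiseOptimum_pred_isTheta hm hcancel hmono hstable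
  refine ⟨⟨?_, ?_⟩, fun π hπ => ?_⟩
  · choose δ hδ hle hge using exists_isExact_isDDP r hunif
    -- Radius and diameter differ by a factor of at most two, so the order found for the pairwise
    -- optimum carries over.
    refine ⟨fun n => δ (n - 1), fun n hn => ?_, Asymptotics.IsTheta.trans ⟨?_, ?_⟩ htheta⟩
    · have := hδ (n - 1)
      rwa [Nat.sub_add_cancel hn] at this
    · refine Asymptotics.IsBigO.of_bound 1 (Filter.Eventually.of_forall fun n => ?_)
      rw [Real.norm_of_nonneg (NNReal.coe_nonneg _), Real.norm_of_nonneg (NNReal.coe_nonneg _),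
        one_mul]
      exact_mod_cast hle (n - 1)
    · refine Asymptotics.IsBigO.of_bound 2 (Filter.Eventually.of_forall fun n => ?_)
      rw [Real.norm_of_nonneg (NNReal.coe_nonneg _), Real.norm_of_nonneg (NNReal.coe_nonneg _)]
      exact_mod_cast hge (n - 1)
  · refine ⟨_, fun n hn => ?_, htheta⟩
    have := isExact_zero (isPairwiseDDP_iff_pairwiseOptimum_le r hunif (n - 1))
    rwa [Nat.sub_add_cancel hn] at this
  · refine ⟨fun n => pairwiseOptimum (rowOutput r.mechanism π (n - 1)), fun n hn => ?_, ?_⟩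
    · have h1 := isDDP_of_pairwiseOptimum_le r hπ (le_refl (pairwiseOptimum
        (rowOutput r.mechanism π (n - 1))))
      have h2 := (isPairwiseDDP_iff_pairwiseOptimum_le r hπ (n - 1) _).2 le_rfl
      rw [Nat.sub_add_cancel hn] at h1 h2
      exact ⟨h1, h2⟩
    · obtain ⟨C₁, hC₁⟩ := pairwiseOptimum_le_exp hm r π
      obtain ⟨C₂, hC₂⟩ := (pairwiseOptimum_pred_isBigO_sqrt r hπ).bound
      refine Asymptotics.IsBigO.of_bound (max C₁ C₂) ?_
      filter_upwards [hC₂, Filter.eventually_ge_atTop 1] with n hn2 hn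
      have hn1 := hC₁ (n - 1)
      rw [Nat.sub_add_cancel hn] at hn1
      rw [Real.norm_of_nonneg (by positivity : (0 : ℝ) ≤ 1 / √(n : ℝ)),
        Real.norm_of_nonneg (NNReal.coe_nonneg _)] at hn2
      rw [Real.norm_of_nonneg (NNReal.coe_nonneg _), Real.norm_of_nonneg (by positivity),
        Real.sqrt_div zero_le_one, Real.sqrt_one]
      rcases min_choice (Real.exp (-((⨅ j, hyperplaneDist (fun V => (π V).toReal) (r.h j)) ^ 2 /
        (3 * (m.factorial : ℝ) * ⨆ V, (π V).toReal)) * n)) (1 / √(n : ℝ)) with h | h <;> rw [h]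
      · exact hn1.trans (mul_le_mul_of_nonneg_right (le_max_left _ _) (Real.exp_pos _).le)
      · exact hn2.trans (mul_le_mul_of_nonneg_right (le_max_right _ _) (by positivity))
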